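/- Let $\mathcal M$ be a model category that has all small limits and colimits, and let $n\ge 1$. Let $\Delta$ be the category of the finite ordered sets $[k]=\{0,\dots,k\}$, $k\ge 0$, and weakly monotone maps, let $\Delta^n$ be the $n$-fold product category, let $D\colon\Delta\to\Delta^n$ be the diagonal embedding $[k]\mapsto([k],\dots,[k])$, $\phi\mapsto(\phi,\dots,\phi)$, and let $$\operatorname{diag}\colon \mathcal M^{\Delta^n}\to\mathcal M^{\Delta},\qquad X\mapsto X\circ D,$$ be the diagonal functor. Regard $\Delta$ and $\Delta^n$ as Reedy categories $\mathcal C$, with inverse subcategory $\overleftarrow{\mathcal C}$ the (componentwise) surjective maps and direct subcategory $\overrightarrow{\mathcal C}$ the (componentwise) injective maps. For $X\in\mathcal M^{\mathcal C}$ and $\alpha\in\mathcal C$, the matching object $M_\alpha X$ is the limit of $X$ over the full subcategory of $\alpha\downarrow\overleftarrow{\mathcal C}$ on all objects other than $\mathrm{id}_\alpha$, and the latching object $L_\alpha X$ is the colimit of $X$ over the full subcategory of $\overrightarrow{\mathcal C}\downarrow\alpha$ on all objects other than $\mathrm{id}_\alpha$. A map $f\colon X\to Y$ of $\mathcal M^{\mathcal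 C}$ is a Reedy fibration if every relative matching map $X_\alpha\to Y_\alpha\times_{M_\alpha Y}M_\alpha X$ is a fibration, a Reedy cofibration if every relative latching map $X_\alpha\amalg_{L_\alpha X}L_\alpha Y\to Y_\alpha$ is a cofibration, and a Reedy weak equivalence if every $f_\alpha$ is a weak equivalence. Then for $\mathcal C=\Delta^n$ and for $\mathcal C=\Delta$ these three classes form a model category structure on $\mathcal M^{\mathcal C}$ (the Reedy model structure), and with respect to these structures $\operatorname{diag}$ is a right Quillen functor: it has a left adjoint, any left adjoint preserves cofibrations and trivial cofibrations, and $\operatorname{diag}$ preserves fibrations and trivial fibrations. The left adjoint sends a cosimplicial object to its left Kan extension along $D$. Moreover, $\operatorname{diag}$ preserves all weak equivalences. -/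

import Mathlib

open CategoryTheory CategoryTheory.Limits HomotopicalAlgebra

universe v u v' u'

namespace ReedyDiagonal

noncomputable section

/-! ### Quillen pairs -/

section Quillen

variable {C : Type u} [Category.{v} C] [ModelCategory C]
  {D : Type u'} [Category.{v'} D] [ModelCategory D]

/-- An adjunction `F ⊣ U` between model categories is a Quillen pair if the left adjoint `F`
preserves cofibrations and trivial cofibrations and the right adjoint `U` preserves fibrations
and trivial fibrations. -/
structure IsQuillenPair {F : D ⥤ C} {U : C ⥤ D} (_adj : F ⊣ U) : Prop where
  cofibration_map {X Y : D} (f : X ⟶ Y) : cofibrations D f → cofibrations C (F.map f)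
  trivialCofibration_map {X Y : D} (f : X ⟶ Y) :
    trivialCofibrations D f → trivialCofibrations C (F.map f)
  fibration_map {X Y : C} (f : X ⟶ Y) : fibrations C f → fibrations D (U.map f)
  trivialFibration_map {X Y : C} (f : X ⟶ Y) :
    trivialFibrations C f → trivialFibrations D (U.map f)

/-- A functor between model categories is a right Quillen functor if it is the right adjoint
of a Quillen pair. -/
def IsRightQuillen (U : C ⥤ D) : Prop :=
  ∃ (F : D ⥤ C) (adj : F ⊣ U), IsQuillenPair adj

end Quillen

/-! ### Reedy classes of morphisms

In this section `C` is a small category, `W₁` stands for the maps of its inverse subcategory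
(the maps that lower the degree) and `W₂` for the maps of its direct subcategory (the maps that
raise the degree). -/

section Reedy

variable {C : Type} [Category.{0} C]

/-- The matching category at `α`: the full subcategory of the undercategory of `α` in the inverse
subcategory `W₁` containing all of the objects except the identity map of `α`. -/
abbrev MatchingCategory (W₁ : MorphismProperty C) [W₁.IsMultiplicative] (α : C) : Type :=
  ObjectProperty.FullSubcategory (C := Under (WideSubcategory.mk (_P := W₁) α))
    (fun A => A ≠ Under.mk (𝟙 _))

/-- The latching category at `α`: the full subcategory of the overcategory of `α` in the direct
subcategory `W₂` containing all of the objects except the identity map of `α`. -/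
abbrev LatchingCategory (W₂ : MorphismProperty C) [W₂.IsMultiplicative] (α : C) : Type :=
  ObjectProperty.FullSubcategory (C := Over (WideSubcategory.mk (_P := W₂) α))
    (fun A => A ≠ Over.mk (𝟙 _))

/-- The functor from the matching category to `C`, sending `α ⟶ β` to `β`. -/
def matchingForget (W₁ : MorphismProperty C) [W₁.IsMultiplicative] (α : C) :
    MatchingCategory W₁ α ⥤ C :=
  ObjectProperty.ι _ ⋙ Under.forget _ ⋙ wideSubcategoryInclusion W₁

/-- The functor from the latching category to `C`, sending `β ⟶ α` to `β`. -/
def latchingForget (W₂ : MorphismProperty C) [W₂.IsMultiplicative] (α : C) :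
    LatchingCategory W₂ α ⥤ C :=
  ObjectProperty.ι _ ⋙ Over.forget _ ⋙ wideSubcategoryInclusion W₂

/-- The map `α ⟶ β` that an object of the matching category consists of. -/
def matchingHom (W₁ : MorphismProperty C) [W₁.IsMultiplicative] {α : C}
    (A : MatchingCategory W₁ α) : α ⟶ (matchingForget W₁ α).obj A :=
  A.obj.hom.hom

/-- The map `β ⟶ α` that an object of the latching category consists of. -/
def latchingHom (W₂ : MorphismProperty C) [W₂.IsMultiplicative] {α : C}
    (A : LatchingCategory W₂ α) : (latchingForget W₂ α).obj A ⟶ α :=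
  A.obj.hom.hom

lemma matchingHom_w (W₁ : MorphismProperty C) [W₁.IsMultiplicative] {α : C}
    {A B : MatchingCategory W₁ α} (g : A ⟶ B) :
    matchingHom W₁ A ≫ (matchingForget W₁ α).map g = matchingHom W₁ B :=
  congrArg InducedWideCategory.Hom.hom (Under.w g.hom)

lemma latchingHom_w (W₂ : MorphismProperty C) [W₂.IsMultiplicative] {α : C}
    {A B : LatchingCategory W₂ α} (g : A ⟶ B) :
    (latchingForget W₂ α).map g ≫ latchingHom W₂ B = latchingHom W₂ A :=
  congrArg InducedWideCategory.Hom.hom (Over.w g.hom)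

variable {M : Type u} [Category.{v} M]

section Matching

variable (W₁ : MorphismProperty C) [W₁.IsMultiplicative]

/-- The cone with point `X_α` over the restriction of `X` to the matching category. -/
@[simps]
def matchingCone (X : C ⥤ M) (α : C) : Cone (matchingForget W₁ α ⋙ X) where
  pt := X.obj α
  π :=
    { app := fun A => X.map (matchingHom W₁ A)
      naturality := fun A B g => by simp [← matchingHom_w W₁ g] }

variable [HasLimitsOfSize.{0, 0} M]

/-- The matching object of `X` at `α`. -/
abbrev matchingObj (X : C ⥤ M) (α : C) : M := limit (matchingForget W₁ α ⋙ X)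

/-- The matching map of `X` at `α`. -/
def matchingMap (X : C ⥤ M) (α : C) : X.obj α ⟶ matchingObj W₁ X α :=
  limit.lift _ (matchingCone W₁ X α)

lemma matchingMap_π (X : C ⥤ M) (α : C) (A : MatchingCategory W₁ α) :
    matchingMap W₁ X α ≫ limit.π (matchingForget W₁ α ⋙ X) A = X.map (matchingHom W₁ A) :=
  limit.lift_π _ _

/-- The map induced on matching objects by a map of diagrams. -/
def matchingObjMap {X Y : C ⥤ M} (f : X ⟶ Y) (α : C) :
    matchingObj W₁ X α ⟶ matchingObj W₁ Y α :=
  limMap (Functor.whiskerLeft (matchingForget W₁ α) f)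

lemma matchingObjMap_π {X Y : C ⥤ M} (f : X ⟶ Y) (α : C) (A : MatchingCategory W₁ α) :
    matchingObjMap W₁ f α ≫ limit.π (matchingForget W₁ α ⋙ Y) A =
      limit.π (matchingForget W₁ α ⋙ X) A ≫ f.app ((matchingForget W₁ α).obj A) :=
  limMap_π _ _

lemma matchingMap_naturality {X Y : C ⥤ M} (f : X ⟶ Y) (α : C) :
    matchingMap W₁ X α ≫ matchingObjMap W₁ f α = f.app α ≫ matchingMap W₁ Y α := by
  apply limit.hom_ext
  intro A
  rw [Category.assoc, Category.assoc, matchingObjMap_π, matchingMap_π, ← f.naturality,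
    ← matchingMap_π, Category.assoc]

/-- The relative matching map `X_α ⟶ Y_α ×_{M_α Y} M_α X` of a map `f : X ⟶ Y`. -/
def relativeMatchingMap {X Y : C ⥤ M} (f : X ⟶ Y) (α : C)
    [HasPullback (matchingMap W₁ Y α) (matchingObjMap W₁ f α)] :
    X.obj α ⟶ pullback (matchingMap W₁ Y α) (matchingObjMap W₁ f α) :=
  pullback.lift (f.app α) (matchingMap W₁ X α) (matchingMap_naturality W₁ f α).symm

end Matching

section Latching

variable (W₂ : MorphismProperty C) [W₂.IsMultiplicative]

/-- The cocone with point `X_α` under the restriction of `X` to the latching category. -/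
@[simps]
def latchingCocone (X : C ⥤ M) (α : C) : Cocone (latchingForget W₂ α ⋙ X) where
  pt := X.obj α
  ι :=
    { app := fun A => X.map (latchingHom W₂ A)
      naturality := fun A B g => by simp [← latchingHom_w W₂ g] }

variable [HasColimitsOfSize.{0, 0} M]

/-- The latching object of `X` at `α`. -/
abbrev latchingObj (X : C ⥤ M) (α : C) : M := colimit (latchingForget W₂ α ⋙ X)

/-- The latching map of `X` at `α`. -/
def latchingMap (X : C ⥤ M) (α : C) : latchingObj W₂ X α ⟶ X.obj α :=
  colimit.desc _ (latchingCocone W₂ X α)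

lemma ι_latchingMap (X : C ⥤ M) (α : C) (A : LatchingCategory W₂ α) :
    colimit.ι (latchingForget W₂ α ⋙ X) A ≫ latchingMap W₂ X α = X.map (latchingHom W₂ A) :=
  colimit.ι_desc _ _

/-- The map induced on latching objects by a map of diagrams. -/
def latchingObjMap {X Y : C ⥤ M} (f : X ⟶ Y) (α : C) :
    latchingObj W₂ X α ⟶ latchingObj W₂ Y α :=
  colimMap (Functor.whiskerLeft (latchingForget W₂ α) f)

lemma ι_latchingObjMap {X Y : C ⥤ M} (f : X ⟶ Y) (α : C) (A : LatchingCategory W₂ α) :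
    colimit.ι (latchingForget W₂ α ⋙ X) A ≫ latchingObjMap W₂ f α =
      f.app ((latchingForget W₂ α).obj A) ≫ colimit.ι (latchingForget W₂ α ⋙ Y) A :=
  ι_colimMap _ _

lemma latchingMap_naturality {X Y : C ⥤ M} (f : X ⟶ Y) (α : C) :
    latchingMap W₂ X α ≫ f.app α = latchingObjMap W₂ f α ≫ latchingMap W₂ Y α := by
  apply colimit.hom_ext
  intro A
  rw [← Category.assoc, ← Category.assoc, ι_latchingObjMap, ι_latchingMap, f.naturality,
    ← ι_latchingMap, Category.assoc]

/-- The relative latching map `X_α ⨿_{L_α X} L_α Y ⟶ Y_α` of a map `f : X ⟶ Y`. -/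
def relativeLatchingMap {X Y : C ⥤ M} (f : X ⟶ Y) (α : C)
    [HasPushout (latchingMap W₂ X α) (latchingObjMap W₂ f α)] :
    pushout (latchingMap W₂ X α) (latchingObjMap W₂ f α) ⟶ Y.obj α :=
  pushout.desc (f.app α) (latchingMap W₂ Y α) (latchingMap_naturality W₂ f α)

end Latching

variable [ModelCategory M] [HasLimitsOfSize.{0, 0} M] [HasColimitsOfSize.{0, 0} M]

/-- Reedy fibrations: the maps all of whose relative matching maps are fibrations. -/
def reedyFibrations (W₁ : MorphismProperty C) [W₁.IsMultiplicative] :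
    MorphismProperty (C ⥤ M) :=
  fun _ _ f => ∀ α : C, fibrations M (relativeMatchingMap W₁ f α)

/-- Reedy cofibrations: the maps all of whose relative latching maps are cofibrations. -/
def reedyCofibrations (W₂ : MorphismProperty C) [W₂.IsMultiplicative] :
    MorphismProperty (C ⥤ M) :=
  fun _ _ f => ∀ α : C, cofibrations M (relativeLatchingMap W₂ f α)

/-- Reedy weak equivalences: the maps that are weak equivalences at every object. -/
def reedyWeakEquivalences : MorphismProperty (C ⥤ M) :=
  fun _ _ f => ∀ α : C, weakEquivalences M (f.app α)

/-- A model category structure on `C ⥤ M` is the Reedy model category structure (with respect to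
the inverse subcategory `W₁` and the direct subcategory `W₂` of `C`) if its three classes of maps
are the Reedy ones. -/
structure IsReedyModelStructure (W₁ W₂ : MorphismProperty C) [W₁.IsMultiplicative]
    [W₂.IsMultiplicative] (S : ModelCategory (C ⥤ M)) : Prop where
  fibrations_eq : fibrations (C ⥤ M) = reedyFibrations W₁
  cofibrations_eq : cofibrations (C ⥤ M) = reedyCofibrations W₂
  weakEquivalences_eq : weakEquivalences (C ⥤ M) = reedyWeakEquivalences

end Reedy

/-! ### Multicosimplicial objects -/

/-- The product category `Δⁿ`. -/
abbrev MultiDelta (n : ℕ) : Type := Fin n → SimplexCategory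

/-- The inverse subcategory of `Δ`: the surjective maps. -/
abbrev deltaInverse : MorphismProperty SimplexCategory :=
  MorphismProperty.surjective SimplexCategory

/-- The direct subcategory of `Δ`: the injective maps. -/
abbrev deltaDirect : MorphismProperty SimplexCategory :=
  MorphismProperty.injective SimplexCategory

/-- The inverse subcategory of the product Reedy category `Δⁿ`: the maps all of whose components
are surjective. -/
abbrev multiDeltaInverse (n : ℕ) : MorphismProperty (MultiDelta n) :=
  MorphismProperty.pi fun _ => deltaInverse

/-- The direct subcategory of the product Reedy category `Δⁿ`: the maps all of whose components
are injective. -/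
abbrev multiDeltaDirect (n : ℕ) : MorphismProperty (MultiDelta n) :=
  MorphismProperty.pi fun _ => deltaDirect

instance (n : ℕ) : (multiDeltaInverse n).IsMultiplicative where
  id_mem X i := deltaInverse.id_mem (X i)
  comp_mem f g hf hg i := deltaInverse.comp_mem (f i) (g i) (hf i) (hg i)

instance (n : ℕ) : (multiDeltaDirect n).IsMultiplicative where
  id_mem X i := deltaDirect.id_mem (X i)
  comp_mem f g hf hg i := deltaDirect.comp_mem (f i) (g i) (hf i) (hg i)

/-- The diagonal embedding `D : Δ ⥤ Δⁿ`, sending `[k]` to `([k], …, [k])`. -/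
abbrev diagonalEmbedding (n : ℕ) : SimplexCategory ⥤ MultiDelta n :=
  Functor.pi' fun _ => 𝟭 SimplexCategory

/-- The diagonal functor from `n`-cosimplicial objects to cosimplicial objects, `X ↦ D ⋙ X`. -/
abbrev diagonal (n : ℕ) (M : Type u) [Category.{v} M] :
    (MultiDelta n ⥤ M) ⥤ (SimplexCategory ⥤ M) :=
  (Functor.whiskeringLeft _ _ M).obj (diagonalEmbedding n)

end

end ReedyDiagonal

/-! Both halves of the proof rest on one reformulation. A map into a matching object is a compatible
family indexed by the maps of the inverse subcategory that lower the degree. So the right lifting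
property of a relative matching map against `l` becomes the limit-free condition `MatchingLift`;
`LatchingLift` is its dual. Since each class of a weak factorization system is determined by lifting
against the other, these conditions characterise the Reedy classes (`relativeMatching_iff`,
`relativeLatching_iff`).

Reedy structure: lifts are built by induction on the degree (`hasLiftingProperty_of_relative`). To
factor `X ⟶ Y`, take in each degree d an intermediate object of the relative matching map and glue
it to X as a cell along all direct maps out of degree d (`exists_attach`). This changes nothing
below degree d and repairs the relative matching maps in degree d. The sequence of these steps
stabilises at every object, so its colimit gives the factorization (`exists_reedy_factorization`).
Induction on the degree identifies the trivial fibrations, and a retract argument the trivial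
cofibrations.

Diagonal: `exists_lift_of_matchingLift` shows that for a Reedy fibration one can lift relative not
only to the whole matching object, but also to a family given on any class S of inverse maps out of
α that is closed under postcomposition with inverse maps. At α = D[k], let S consist of the
surjections σ : D[k] ⟶ β whose components factor jointly through a proper quotient of [k]. There is
a smallest such quotient, the joint image, and every factorization of σ through some D[m], with [k]
⟶ [m] surjective, maps to the one through it. A family over the proper surjections out of [k]
therefore extends to S, and the lift over S gives the lift for the diagonal
(`MatchingLift.diagonal`). Hence the diagonal preserves fibrations; it preserves weak equivalences
because they are levelwise, and the Quillen property follows by adjunction. -/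

namespace ReedyDiagonal

noncomputable section

/-! ### Compatible families of maps -/

section Families

variable {C : Type} [Category.{0} C] {M : Type u} [Category.{v} M]

/-- A family of maps `T ⟶ X_β`, indexed by the maps `α ⟶ β` satisfying `S`, which is compatible
with the maps of `W₁`. -/
structure MatchingFamily (W₁ : MorphismProperty C) (X : C ⥤ M) (α : C)
    (S : ∀ ⦃β : C⦄, (α ⟶ β) → Prop) (T : M) where
  map : ∀ {β : C} (σ : α ⟶ β), S σ → (T ⟶ X.obj β)
  comp : ∀ {β γ : C} (σ : α ⟶ β) (τ : β ⟶ γ) (ρ : α ⟶ γ) (hσ : S σ) (hρ : S ρ), W₁ τ →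
    σ ≫ τ = ρ → map σ hσ ≫ X.map τ = map ρ hρ

/-- A family of maps `X_β ⟶ T`, indexed by the maps `β ⟶ α` satisfying `S`, which is compatible
with the maps of `W₂`. -/
structure LatchingFamily (W₂ : MorphismProperty C) (X : C ⥤ M) (α : C)
    (S : ∀ ⦃β : C⦄, (β ⟶ α) → Prop) (T : M) where
  map : ∀ {β : C} (δ : β ⟶ α), S δ → (X.obj β ⟶ T)
  comp : ∀ {β γ : C} (δ : β ⟶ α) (τ : γ ⟶ β) (ρ : γ ⟶ α) (hδ : S δ) (hρ : S ρ), W₂ τ →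
    τ ≫ δ = ρ → X.map τ ≫ map δ hδ = map ρ hρ

variable {W₁ W₂ : MorphismProperty C} [W₁.IsMultiplicative] [W₂.IsMultiplicative]
  (r : ReedyStructure W₁ W₂ ℕ)

/-- The maps out of `α` of the inverse subcategory that lower the degree. -/
def Lowering (α : C) ⦃β : C⦄ (σ : α ⟶ β) : Prop := W₁ σ ∧ r.deg β < r.deg α

/-- The maps into `α` of the direct subcategory that raise the degree. -/
def Raising (α : C) ⦃β : C⦄ (δ : β ⟶ α) : Prop := W₂ δ ∧ r.deg β < r.deg α

variable {r}

lemma Lowering.comp {α β γ : C} {σ : α ⟶ β} (hσ : Lowering r α σ) {τ : β ⟶ γ} (hτ : W₁ τ) :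
    Lowering r α (σ ≫ τ) :=
  ⟨W₁.comp_mem _ _ hσ.1 hτ, (r.le₁ τ hτ).trans_lt hσ.2⟩

lemma Raising.comp {α β γ : C} {δ : β ⟶ α} (hδ : Raising r α δ) {τ : γ ⟶ β} (hτ : W₂ τ) :
    Raising r α (τ ≫ δ) :=
  ⟨W₂.comp_mem _ _ hτ hδ.1, (r.le₂ τ hτ).trans_lt hδ.2⟩

/-- A nonidentity inverse map strictly lowers the degree, so the matching category, which omits only
the identity, has exactly the lowering maps as objects. -/
lemma lowering_matchingHom {α : C} (A : MatchingCategory W₁ α) :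
    Lowering r α (matchingHom W₁ A) := by
  refine ⟨A.obj.hom.property, r.lt₁ _ A.obj.hom.property fun h => A.property ?_⟩
  obtain ⟨⟨⟨⟨⟩⟩, ⟨β⟩, ⟨σ, hσ⟩⟩, hA⟩ := A
  change MorphismProperty.identities C σ at h
  cases h
  rfl

lemma raising_latchingHom {α : C} (A : LatchingCategory W₂ α) :
    Raising r α (latchingHom W₂ A) := by
  refine ⟨A.obj.hom.property, r.lt₂ _ A.obj.hom.property fun h => A.property ?_⟩
  obtain ⟨⟨⟨β⟩, ⟨⟨⟩⟩, ⟨σ, hσ⟩⟩, hA⟩ := A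
  change MorphismProperty.identities C σ at h
  cases h
  rfl

/-- The object of the matching category given by a map that lowers the degree. -/
def Lowering.toMatchingCategory {α β : C} {σ : α ⟶ β} (hσ : Lowering r α σ) :
    MatchingCategory W₁ α :=
  ⟨Under.mk (Y := WideSubcategory.mk β) (⟨σ, hσ.1⟩ : InducedWideCategory.Hom _ _), fun h =>
    hσ.2.ne (congrArg (fun A : Under (WideSubcategory.mk (_P := W₁) α) => r.deg A.right.obj) h)⟩

/-- The object of the latching category given by a map that raises the degree. -/
def Raising.toLatchingCategory {α β : C} {δ : β ⟶ α} (hδ : Raising r α δ) :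
    LatchingCategory W₂ α :=
  ⟨Over.mk (Y := WideSubcategory.mk β) (⟨δ, hδ.1⟩ : InducedWideCategory.Hom _ _), fun h =>
    hδ.2.ne (congrArg (fun A : Over (WideSubcategory.mk (_P := W₂) α) => r.deg A.left.obj) h)⟩

section Matching

variable [HasLimitsOfSize.{0, 0} M]

/-- The projection of the matching object given by a map that lowers the degree. -/
def matchingπ (X : C ⥤ M) {α β : C} (σ : α ⟶ β) (hσ : Lowering r α σ) :
    matchingObj W₁ X α ⟶ X.obj β :=
  limit.π (matchingForget W₁ α ⋙ X) hσ.toMatchingCategory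

variable (r) in
lemma matchingObj_hom_ext {X : C ⥤ M} {α : C} {T : M} {f g : T ⟶ matchingObj W₁ X α}
    (h : ∀ ⦃β : C⦄ (σ : α ⟶ β) (hσ : Lowering r α σ), f ≫ matchingπ X σ hσ = g ≫ matchingπ X σ hσ) :
    f = g :=
  limit.hom_ext fun A => h _ (lowering_matchingHom A)

@[simp]
lemma matchingMap_matchingπ (X : C ⥤ M) {α β : C} (σ : α ⟶ β) (hσ : Lowering r α σ) :
    matchingMap W₁ X α ≫ matchingπ X σ hσ = X.map σ :=
  matchingMap_π W₁ X α _

@[simp]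
lemma matchingObjMap_matchingπ {X Y : C ⥤ M} (f : X ⟶ Y) {α β : C} (σ : α ⟶ β)
    (hσ : Lowering r α σ) :
    matchingObjMap W₁ f α ≫ matchingπ Y σ hσ = matchingπ X σ hσ ≫ f.app β :=
  matchingObjMap_π W₁ f α _

/-- The family of maps corresponding to a map into the matching object. -/
@[simps]
def matchingFamilyOfHom {X : C ⥤ M} {α : C} {T : M} (f : T ⟶ matchingObj W₁ X α) :
    MatchingFamily W₁ X α (Lowering r α) T where
  map σ hσ := f ≫ matchingπ X σ hσ
  comp σ τ ρ hσ hρ hτ h := by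
    let g : hσ.toMatchingCategory.obj.right ⟶ hρ.toMatchingCategory.obj.right := ⟨τ, hτ⟩
    have hg : hσ.toMatchingCategory.obj.hom ≫ g = hρ.toMatchingCategory.obj.hom :=
      InducedWideCategory.Hom.ext h
    have := limit.w (matchingForget W₁ α ⋙ X)
      (show hσ.toMatchingCategory ⟶ hρ.toMatchingCategory from
        ObjectProperty.homMk (Under.homMk g hg))
    rw [Category.assoc]
    exact congrArg (f ≫ ·) this

/-- The cone corresponding to a family of maps. -/
def MatchingFamily.cone {X : C ⥤ M} {α : C} {T : M} (b : MatchingFamily W₁ X α (Lowering r α) T) :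
    Cone (matchingForget W₁ α ⋙ X) where
  pt := T
  π :=
    { app := fun (A : MatchingCategory W₁ α) => b.map (matchingHom W₁ A) (lowering_matchingHom A)
      naturality := fun (A B : MatchingCategory W₁ α) g => by
        have := b.comp (matchingHom W₁ A) ((matchingForget W₁ α).map g) (matchingHom W₁ B)
          (lowering_matchingHom A) (lowering_matchingHom B) g.hom.right.property
          (matchingHom_w W₁ g)
        simpa using this.symm }

/-- The map into the matching object corresponding to a family of maps. -/
def MatchingFamily.lift {X : C ⥤ M} {α : C} {T : M} (b : MatchingFamily W₁ X α (Lowering r α) T) :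
    T ⟶ matchingObj W₁ X α :=
  limit.lift _ b.cone

@[simp]
lemma MatchingFamily.lift_π {X : C ⥤ M} {α : C} {T : M}
    (b : MatchingFamily W₁ X α (Lowering r α) T) {β : C} (σ : α ⟶ β) (hσ : Lowering r α σ) :
    b.lift ≫ matchingπ X σ hσ = b.map σ hσ :=
  limit.lift_π b.cone hσ.toMatchingCategory

@[simp]
lemma MatchingFamily.lift_π_assoc {X : C ⥤ M} {α : C} {T : M}
    (b : MatchingFamily W₁ X α (Lowering r α) T) {β : C} (σ : α ⟶ β) (hσ : Lowering r α σ) {Z : M}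
    (h : X.obj β ⟶ Z) :
    b.lift ≫ matchingπ X σ hσ ≫ h = b.map σ hσ ≫ h := by
  simp only [← Category.assoc, MatchingFamily.lift_π]

@[simp]
lemma relativeMatchingMap_fst {X Y : C ⥤ M} (p : X ⟶ Y) (α : C)
    [HasPullback (matchingMap W₁ Y α) (matchingObjMap W₁ p α)] :
    relativeMatchingMap W₁ p α ≫ pullback.fst _ _ = p.app α :=
  pullback.lift_fst _ _ _

@[simp]
lemma relativeMatchingMap_snd {X Y : C ⥤ M} (p : X ⟶ Y) (α : C)
    [HasPullback (matchingMap W₁ Y α) (matchingObjMap W₁ p α)] :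
    relativeMatchingMap W₁ p α ≫ pullback.snd _ _ = matchingMap W₁ X α :=
  pullback.lift_snd _ _ _

@[simp]
lemma relativeMatchingMap_snd_assoc {X Y : C ⥤ M} (p : X ⟶ Y) (α : C)
    [HasPullback (matchingMap W₁ Y α) (matchingObjMap W₁ p α)] {Z : M}
    (h : matchingObj W₁ X α ⟶ Z) :
    relativeMatchingMap W₁ p α ≫ pullback.snd _ _ ≫ h = matchingMap W₁ X α ≫ h := by
  simp only [← Category.assoc, relativeMatchingMap_snd]

variable (r) in
/-- The lifting property of `l` with respect to the relative matching map of `p` at `α`, in terms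
of families of maps. -/
def MatchingLift {X Y : C ⥤ M} (p : X ⟶ Y) (α : C) {A T : M} (l : A ⟶ T) : Prop :=
  ∀ (a : A ⟶ X.obj α) (y : T ⟶ Y.obj α) (b : MatchingFamily W₁ X α (Lowering r α) T),
    a ≫ p.app α = l ≫ y →
    (∀ ⦃β : C⦄ (σ : α ⟶ β) (hσ : Lowering r α σ), a ≫ X.map σ = l ≫ b.map σ hσ) →
    (∀ ⦃β : C⦄ (σ : α ⟶ β) (hσ : Lowering r α σ), b.map σ hσ ≫ p.app β = y ≫ Y.map σ) →
    ∃ w : T ⟶ X.obj α, l ≫ w = a ∧ w ≫ p.app α = y ∧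
      ∀ ⦃β : C⦄ (σ : α ⟶ β) (hσ : Lowering r α σ), w ≫ X.map σ = b.map σ hσ

-- A map from T to the pullback is a map to `Y.obj α` together with a map to the matching object of
-- X, that is, a compatible family. After this translation the later arguments need no limits.
variable (r) in
lemma hasLiftingProperty_relativeMatchingMap_iff {X Y : C ⥤ M} (p : X ⟶ Y) (α : C)
    [HasPullback (matchingMap W₁ Y α) (matchingObjMap W₁ p α)] {A T : M} (l : A ⟶ T) :
    HasLiftingProperty l (relativeMatchingMap W₁ p α) ↔ MatchingLift r p α l := by
  constructor
  · intro _ a y b h₁ h₂ h₃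
    have ht : y ≫ matchingMap W₁ Y α = b.lift ≫ matchingObjMap W₁ p α :=
      matchingObj_hom_ext r fun β σ hσ => by simp [h₃]
    obtain ⟨t, t₁, t₂⟩ : ∃ t : T ⟶ pullback (matchingMap W₁ Y α) (matchingObjMap W₁ p α),
        t ≫ pullback.fst _ _ = y ∧ t ≫ pullback.snd _ _ = b.lift :=
      ⟨pullback.lift y b.lift ht, pullback.lift_fst _ _ _, pullback.lift_snd _ _ _⟩
    have sq : CommSq a l (relativeMatchingMap W₁ p α) t := ⟨by
      apply pullback.hom_ext
      · simp [h₁, t₁]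
      · exact matchingObj_hom_ext r fun β σ hσ => by simp [h₂ σ hσ, reassoc_of% t₂]⟩
    obtain ⟨⟨w, hw₁, hw₂⟩⟩ := (HasLiftingProperty.sq_hasLift sq).exists_lift
    refine ⟨w, hw₁, ?_, fun β σ hσ => ?_⟩
    · rw [← t₁, ← hw₂, Category.assoc, relativeMatchingMap_fst]
    · rw [← b.lift_π, ← t₂, ← hw₂]
      simp only [Category.assoc, relativeMatchingMap_snd_assoc, matchingMap_matchingπ]
  · intro H
    refine ⟨fun {a t} sq => ?_⟩
    obtain ⟨w, h₁, h₂, h₃⟩ := H a (t ≫ pullback.fst _ _)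
      (matchingFamilyOfHom (t ≫ pullback.snd _ _))
      (by simpa using sq.w =≫ pullback.fst _ _)
      (fun β σ hσ => by simpa using sq.w =≫ (pullback.snd _ _ ≫ matchingπ X σ hσ))
      (fun β σ hσ => by
        simpa using (t ≫= pullback.condition (f := matchingMap W₁ Y α)
          (g := matchingObjMap W₁ p α) =≫ matchingπ Y σ hσ).symm)
    refine ⟨⟨⟨w, h₁, ?_⟩⟩⟩
    apply pullback.hom_ext
    · simpa using h₂
    · exact matchingObj_hom_ext r fun β σ hσ => by simpa using h₃ σ hσ

end Matching

section Latching

variable [HasColimitsOfSize.{0, 0} M]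

/-- The inclusion into the latching object given by a map that raises the degree. -/
def latchingι (X : C ⥤ M) {α β : C} (δ : β ⟶ α) (hδ : Raising r α δ) :
    X.obj β ⟶ latchingObj W₂ X α :=
  colimit.ι (latchingForget W₂ α ⋙ X) hδ.toLatchingCategory

variable (r) in
lemma latchingObj_hom_ext {X : C ⥤ M} {α : C} {T : M} {f g : latchingObj W₂ X α ⟶ T}
    (h : ∀ ⦃β : C⦄ (δ : β ⟶ α) (hδ : Raising r α δ), latchingι X δ hδ ≫ f = latchingι X δ hδ ≫ g) :
    f = g :=
  colimit.hom_ext fun A => h _ (raising_latchingHom A)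

@[simp]
lemma latchingι_latchingMap (X : C ⥤ M) {α β : C} (δ : β ⟶ α) (hδ : Raising r α δ) :
    latchingι X δ hδ ≫ latchingMap W₂ X α = X.map δ :=
  ι_latchingMap W₂ X α _

@[simp]
lemma latchingι_latchingMap_assoc (X : C ⥤ M) {α β : C} (δ : β ⟶ α) (hδ : Raising r α δ) {Z : M}
    (h : X.obj α ⟶ Z) :
    latchingι X δ hδ ≫ latchingMap W₂ X α ≫ h = X.map δ ≫ h := by
  simp only [← Category.assoc, latchingι_latchingMap]

@[simp]
lemma latchingι_latchingObjMap {X Y : C ⥤ M} (f : X ⟶ Y) {α β : C} (δ : β ⟶ α)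
    (hδ : Raising r α δ) :
    latchingι X δ hδ ≫ latchingObjMap W₂ f α = f.app β ≫ latchingι Y δ hδ :=
  ι_latchingObjMap W₂ f α _

@[simp]
lemma latchingι_latchingObjMap_assoc {X Y : C ⥤ M} (f : X ⟶ Y) {α β : C} (δ : β ⟶ α)
    (hδ : Raising r α δ) {Z : M}
    (h : latchingObj W₂ Y α ⟶ Z) :
    latchingι X δ hδ ≫ latchingObjMap W₂ f α ≫ h = f.app β ≫ latchingι Y δ hδ ≫ h := by
  simp only [← Category.assoc, latchingι_latchingObjMap]

/-- The family of maps corresponding to a map out of the latching object. -/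
@[simps]
def latchingFamilyOfHom {X : C ⥤ M} {α : C} {T : M} (f : latchingObj W₂ X α ⟶ T) :
    LatchingFamily W₂ X α (Raising r α) T where
  map δ hδ := latchingι X δ hδ ≫ f
  comp δ τ ρ hδ hρ hτ h := by
    have := colimit.w (latchingForget W₂ α ⋙ X)
      (show hρ.toLatchingCategory ⟶ hδ.toLatchingCategory from
        ObjectProperty.homMk (Over.homMk (⟨τ, hτ⟩ : InducedWideCategory.Hom _ _)
          (InducedWideCategory.Hom.ext h)))
    rw [← Category.assoc]
    exact congrArg (· ≫ f) this

/-- The cocone corresponding to a family of maps. -/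
def LatchingFamily.cocone {X : C ⥤ M} {α : C} {T : M}
    (b : LatchingFamily W₂ X α (Raising r α) T) : Cocone (latchingForget W₂ α ⋙ X) where
  pt := T
  ι :=
    { app := fun (A : LatchingCategory W₂ α) => b.map (latchingHom W₂ A) (raising_latchingHom A)
      naturality := fun (A B : LatchingCategory W₂ α) g => by
        have := b.comp (latchingHom W₂ B) ((latchingForget W₂ α).map g) (latchingHom W₂ A)
          (raising_latchingHom B) (raising_latchingHom A) g.hom.left.property
          (latchingHom_w W₂ g)
        simpa using this }

/-- The map out of the latching object corresponding to a family of maps. -/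
def LatchingFamily.desc {X : C ⥤ M} {α : C} {T : M} (b : LatchingFamily W₂ X α (Raising r α) T) :
    latchingObj W₂ X α ⟶ T :=
  colimit.desc _ b.cocone

@[simp]
lemma LatchingFamily.ι_desc {X : C ⥤ M} {α : C} {T : M}
    (b : LatchingFamily W₂ X α (Raising r α) T) {β : C} (δ : β ⟶ α) (hδ : Raising r α δ) :
    latchingι X δ hδ ≫ b.desc = b.map δ hδ :=
  colimit.ι_desc b.cocone hδ.toLatchingCategory

@[simp]
lemma LatchingFamily.ι_desc_assoc {X : C ⥤ M} {α : C} {T : M}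
    (b : LatchingFamily W₂ X α (Raising r α) T) {β : C} (δ : β ⟶ α) (hδ : Raising r α δ) {Z : M}
    (h : T ⟶ Z) :
    latchingι X δ hδ ≫ b.desc ≫ h = b.map δ hδ ≫ h := by
  simp only [← Category.assoc, LatchingFamily.ι_desc]

@[simp]
lemma inl_relativeLatchingMap {X Y : C ⥤ M} (i : X ⟶ Y) (α : C)
    [HasPushout (latchingMap W₂ X α) (latchingObjMap W₂ i α)] :
    pushout.inl _ _ ≫ relativeLatchingMap W₂ i α = i.app α :=
  pushout.inl_desc _ _ _

@[simp]
lemma inl_relativeLatchingMap_assoc {X Y : C ⥤ M} (i : X ⟶ Y) (α : C)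
    [HasPushout (latchingMap W₂ X α) (latchingObjMap W₂ i α)] {Z : M}
    (h : Y.obj α ⟶ Z) :
    pushout.inl _ _ ≫ relativeLatchingMap W₂ i α ≫ h = i.app α ≫ h := by
  simp only [← Category.assoc, inl_relativeLatchingMap]

@[simp]
lemma inr_relativeLatchingMap {X Y : C ⥤ M} (i : X ⟶ Y) (α : C)
    [HasPushout (latchingMap W₂ X α) (latchingObjMap W₂ i α)] :
    pushout.inr _ _ ≫ relativeLatchingMap W₂ i α = latchingMap W₂ Y α :=
  pushout.inr_desc _ _ _

@[simp]
lemma inr_relativeLatchingMap_assoc {X Y : C ⥤ M} (i : X ⟶ Y) (α : C)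
    [HasPushout (latchingMap W₂ X α) (latchingObjMap W₂ i α)] {Z : M}
    (h : Y.obj α ⟶ Z) :
    pushout.inr _ _ ≫ relativeLatchingMap W₂ i α ≫ h = latchingMap W₂ Y α ≫ h := by
  simp only [← Category.assoc, inr_relativeLatchingMap]

variable (r) in
/-- The lifting property of the relative latching map of `i` at `α` with respect to `q`, in terms
of families of maps. -/
def LatchingLift {X Y : C ⥤ M} (i : X ⟶ Y) (α : C) {E B : M} (q : E ⟶ B) : Prop :=
  ∀ (x : X.obj α ⟶ E) (y : Y.obj α ⟶ B) (e : LatchingFamily W₂ Y α (Raising r α) E),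
    x ≫ q = i.app α ≫ y →
    (∀ ⦃β : C⦄ (δ : β ⟶ α) (hδ : Raising r α δ), X.map δ ≫ x = i.app β ≫ e.map δ hδ) →
    (∀ ⦃β : C⦄ (δ : β ⟶ α) (hδ : Raising r α δ), e.map δ hδ ≫ q = Y.map δ ≫ y) →
    ∃ w : Y.obj α ⟶ E, i.app α ≫ w = x ∧ w ≫ q = y ∧
      ∀ ⦃β : C⦄ (δ : β ⟶ α) (hδ : Raising r α δ), Y.map δ ≫ w = e.map δ hδ

variable (r) in
lemma hasLiftingProperty_relativeLatchingMap_iff {X Y : C ⥤ M} (i : X ⟶ Y) (α : C)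
    [HasPushout (latchingMap W₂ X α) (latchingObjMap W₂ i α)] {E B : M} (q : E ⟶ B) :
    HasLiftingProperty (relativeLatchingMap W₂ i α) q ↔ LatchingLift r i α q := by
  constructor
  · intro _ x y e h₁ h₂ h₃
    have ht : latchingMap W₂ X α ≫ x = latchingObjMap W₂ i α ≫ e.desc :=
      latchingObj_hom_ext r fun β δ hδ => by simp [h₂ δ hδ]
    obtain ⟨t, t₁, t₂⟩ : ∃ t : pushout (latchingMap W₂ X α) (latchingObjMap W₂ i α) ⟶ E,
        pushout.inl _ _ ≫ t = x ∧ pushout.inr _ _ ≫ t = e.desc :=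
      ⟨pushout.desc x e.desc ht, pushout.inl_desc _ _ _, pushout.inr_desc _ _ _⟩
    have sq : CommSq t (relativeLatchingMap W₂ i α) q y := ⟨by
      apply pushout.hom_ext
      · simp [h₁, reassoc_of% t₁]
      · exact latchingObj_hom_ext r fun β δ hδ => by simp [h₃, reassoc_of% t₂]⟩
    obtain ⟨⟨w, hw₁, hw₂⟩⟩ := (HasLiftingProperty.sq_hasLift sq).exists_lift
    refine ⟨w, ?_, hw₂, fun β δ hδ => ?_⟩
    · rw [← t₁, ← hw₁, inl_relativeLatchingMap_assoc]
    · rw [← e.ι_desc, ← t₂, ← hw₁, inr_relativeLatchingMap_assoc,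
        latchingι_latchingMap_assoc]
  · intro H
    refine ⟨fun {t y} sq => ?_⟩
    obtain ⟨w, h₁, h₂, h₃⟩ := H (pushout.inl _ _ ≫ t) y
      (latchingFamilyOfHom (pushout.inr _ _ ≫ t))
      (by simpa using pushout.inl _ _ ≫= sq.w)
      (fun β δ hδ => by
        simpa using latchingι X δ hδ ≫= pushout.condition (f := latchingMap W₂ X α)
          (g := latchingObjMap W₂ i α) =≫ t)
      (fun β δ hδ => by simpa using (latchingι Y δ hδ ≫ pushout.inr _ _) ≫= sq.w)
    refine ⟨⟨⟨w, ?_, h₂⟩⟩⟩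
    apply pushout.hom_ext
    · simpa using h₁
    · exact latchingObj_hom_ext r fun β δ hδ => by simpa using h₃ δ hδ

end Latching

end Families

/-! ### Extension of compatible families -/

section Extension

variable {C : Type} [Category.{0} C] {M : Type u} [Category.{v} M]
  {W₁ W₂ : MorphismProperty C} [W₁.IsMultiplicative] [W₂.IsMultiplicative]
  {r : ReedyStructure W₁ W₂ ℕ}

/-- Extension of a lift from the maps out of `α` satisfying `S` to those satisfying `S'`. -/
lemma MatchingFamily.exists_extension {X Y : C ⥤ M} (p : X ⟶ Y) {α : C} {A T : M} (l : A ⟶ T)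
    {S S' : ∀ ⦃β : C⦄, (α ⟶ β) → Prop} (hS' : ∀ ⦃β : C⦄ (σ : α ⟶ β), S' σ → W₁ σ)
    (hSS' : ∀ ⦃β : C⦄ (σ : α ⟶ β), S σ → S' σ)
    (hS : ∀ ⦃β γ : C⦄ (σ : α ⟶ β) (τ : β ⟶ γ), S σ → W₁ τ → S (σ ≫ τ))
    (hSc : ∀ ⦃β γ : C⦄ (σ : α ⟶ β) (τ : β ⟶ γ), S' σ → W₁ τ → S' (σ ≫ τ))
    (hp : ∀ ⦃β : C⦄ (σ : α ⟶ β), S' σ → ¬ S σ → MatchingLift r p β l)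
    (a : MatchingFamily W₁ X α S' A) (y : MatchingFamily W₁ Y α S' T)
    (b : MatchingFamily W₁ X α S T)
    (h₁ : ∀ ⦃β : C⦄ (σ : α ⟶ β) (hσ : S' σ), a.map σ hσ ≫ p.app β = l ≫ y.map σ hσ)
    (h₂ : ∀ ⦃β : C⦄ (σ : α ⟶ β) (hσ : S σ), a.map σ (hSS' σ hσ) = l ≫ b.map σ hσ)
    (h₃ : ∀ ⦃β : C⦄ (σ : α ⟶ β) (hσ : S σ), b.map σ hσ ≫ p.app β = y.map σ (hSS' σ hσ)) :
    ∃ w : MatchingFamily W₁ X α S' T,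
      (∀ ⦃β : C⦄ (σ : α ⟶ β) (hσ : S' σ), l ≫ w.map σ hσ = a.map σ hσ) ∧
      (∀ ⦃β : C⦄ (σ : α ⟶ β) (hσ : S' σ), w.map σ hσ ≫ p.app β = y.map σ hσ) ∧
      ∀ ⦃β : C⦄ (σ : α ⟶ β) (hσ : S σ), w.map σ (hSS' σ hσ) = b.map σ hσ := by
  classical
  -- Induction on the degree of the target β: stage d has values on S and on all maps of S' into
  -- objects of degree below d.
  have key : ∀ d : ℕ, ∃ w : MatchingFamily W₁ X α
      (fun β σ => S' σ ∧ (S σ ∨ r.deg β < d)) T,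
      (∀ ⦃β : C⦄ (σ : α ⟶ β) hσ, l ≫ w.map σ hσ = a.map σ hσ.1) ∧
      (∀ ⦃β : C⦄ (σ : α ⟶ β) hσ, w.map σ hσ ≫ p.app β = y.map σ hσ.1) ∧
      ∀ ⦃β : C⦄ (σ : α ⟶ β) (hσ : S σ), w.map σ ⟨hSS' σ hσ, Or.inl hσ⟩ = b.map σ hσ := by
    intro d
    induction d with
    | zero =>
      have aux : ∀ ⦃β : C⦄ (σ : α ⟶ β), (S' σ ∧ (S σ ∨ r.deg β < 0)) → S σ :=
        fun β σ hσ => hσ.2.resolve_right (Nat.not_lt_zero _)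
      exact ⟨⟨fun σ hσ => b.map σ (aux σ hσ),
        fun σ τ ρ hσ hρ hτ h => b.comp σ τ ρ (aux σ hσ) (aux ρ hρ) hτ h⟩,
        fun β σ hσ => (h₂ σ (aux σ hσ)).symm, fun β σ hσ => h₃ σ (aux σ hσ), fun β σ hσ => rfl⟩
    | succ d ih =>
      obtain ⟨w, w₁, w₂, w₃⟩ := ih
      have hτ' : ∀ ⦃β γ : C⦄ (σ : α ⟶ β) (τ : β ⟶ γ), S' σ → r.deg β = d → Lowering r β τ →
          S' (σ ≫ τ) ∧ (S (σ ≫ τ) ∨ r.deg γ < d) := fun β γ σ τ hσ hβ hτ =>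
        ⟨hSc σ τ hσ hτ.1, Or.inr (hβ ▸ hτ.2)⟩
      have step : ∀ ⦃β : C⦄ (σ : α ⟶ β) (hσ : S' σ) (_ : ¬ S σ) (hβ : r.deg β = d),
          ∃ c : T ⟶ X.obj β, l ≫ c = a.map σ hσ ∧ c ≫ p.app β = y.map σ hσ ∧
            ∀ ⦃γ : C⦄ (τ : β ⟶ γ) (hτ : Lowering r β τ),
              c ≫ X.map τ = w.map (σ ≫ τ) (hτ' σ τ hσ hβ hτ) := by
        intro β σ hσ hσ' hβ
        -- A lowering map τ out of β lands in degree below d, so the values already found at σ ≫ τ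
        -- form the family over which the value at σ is lifted.
        refine hp σ hσ hσ' (a.map σ hσ) (y.map σ hσ)
          ⟨fun τ hτ => w.map (σ ≫ τ) (hτ' σ τ hσ hβ hτ), fun τ τ' ρ hτ hρ h h' =>
            w.comp _ _ _ _ _ h (by rw [Category.assoc, h'])⟩ (h₁ σ hσ) ?_ ?_
        · intro γ τ hτ
          rw [w₁, a.comp σ τ _ hσ (hSc σ τ hσ hτ.1) hτ.1 rfl]
        · intro γ τ hτ
          rw [w₂, y.comp σ τ _ hσ (hSc σ τ hσ hτ.1) hτ.1 rfl]
      choose c c₁ c₂ c₃ using step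
      have aux : ∀ ⦃β : C⦄ (σ : α ⟶ β), (S' σ ∧ (S σ ∨ r.deg β < d + 1)) →
          ¬ (S' σ ∧ (S σ ∨ r.deg β < d)) → ¬ S σ ∧ r.deg β = d := by
        intro β σ hσ hσ'
        have : ¬ S σ := fun h => hσ' ⟨hσ.1, Or.inl h⟩
        have : ¬ r.deg β < d := fun h => hσ' ⟨hσ.1, Or.inr h⟩
        have := hσ.2
        exact ⟨by assumption, by grind⟩
      refine ⟨⟨fun σ hσ => if h : S' σ ∧ (S σ ∨ _ < d) then w.map σ h else
        c σ hσ.1 (aux σ hσ h).1 (aux σ hσ h).2, ?_⟩, ?_, ?_, ?_⟩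
      · intro β γ σ τ ρ hσ hρ hτ h
        subst h
        by_cases hσ' : S' σ ∧ (S σ ∨ r.deg β < d)
        · have hρ' : S' (σ ≫ τ) ∧ (S (σ ≫ τ) ∨ r.deg γ < d) :=
            ⟨hρ.1, hσ'.2.imp (fun h => hS σ τ h hτ) fun h => (r.le₁ τ hτ).trans_lt h⟩
          rw [dif_pos hσ', dif_pos hρ']
          exact w.comp _ _ _ _ _ hτ rfl
        · have hβ := (aux σ hσ hσ').2
          by_cases hγ : r.deg γ < r.deg β
          · rw [dif_neg hσ', dif_pos (hτ' σ τ hσ.1 hβ ⟨hτ, hγ⟩)]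
            exact c₃ σ hσ.1 _ _ τ ⟨hτ, hγ⟩
          -- An inverse map that preserves the degree is an identity, so distinct new values are
          -- subject to no mutual constraint.
          · obtain ⟨⟩ := r.identities_of_prop₁_of_eq hτ (le_antisymm (not_lt.1 hγ) (r.le₁ τ hτ))
            simp
      · intro β σ hσ
        dsimp only
        split_ifs
        exacts [w₁ _ _, c₁ _ _ _ _]
      · intro β σ hσ
        dsimp only
        split_ifs
        exacts [w₂ _ _, c₂ _ _ _ _]
      · intro β σ hσ
        dsimp only
        rw [dif_pos ⟨hSS' σ hσ, Or.inl hσ⟩]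
        exact w₃ _ _
  -- Inverse maps never raise the degree, so every target of a map in S' has degree at most that of
  -- α.
  obtain ⟨w, w₁, w₂, w₃⟩ := key (r.deg α + 1)
  have aux : ∀ ⦃β : C⦄ (σ : α ⟶ β), S' σ → (S' σ ∧ (S σ ∨ r.deg β < r.deg α + 1)) :=
    fun β σ hσ => ⟨hσ, Or.inr (Nat.lt_succ_of_le (r.le₁ σ (hS' σ hσ)))⟩
  exact ⟨⟨fun σ hσ => w.map σ (aux σ hσ), fun σ τ ρ hσ hρ => w.comp σ τ ρ (aux σ hσ) (aux ρ hρ)⟩,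
    fun β σ hσ => w₁ σ (aux σ hσ), fun β σ hσ => w₂ σ (aux σ hσ), fun β σ hσ => w₃ σ hσ⟩

/-- The family of maps out of `α` obtained from a map to `X_α`. -/
@[simps]
def MatchingFamily.ofHom {X : C ⥤ M} {α : C} (S : ∀ ⦃β : C⦄, (α ⟶ β) → Prop) {T : M}
    (f : T ⟶ X.obj α) : MatchingFamily W₁ X α S T where
  map σ _ := f ≫ X.map σ
  comp σ τ ρ _ _ _ h := by simp [← h]

/-- If the relative matching maps of `p` have the right lifting property with respect to `l`,
then lifts can be found which extend a given family defined on a class of maps out of `α`. -/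
lemma exists_lift_of_matchingLift {X Y : C ⥤ M} (p : X ⟶ Y) {A T : M} (l : A ⟶ T)
    (hp : ∀ β : C, MatchingLift r p β l) {α : C} {S : ∀ ⦃β : C⦄, (α ⟶ β) → Prop}
    (hS' : ∀ ⦃β : C⦄ (σ : α ⟶ β), S σ → W₁ σ)
    (hS : ∀ ⦃β γ : C⦄ (σ : α ⟶ β) (τ : β ⟶ γ), S σ → W₁ τ → S (σ ≫ τ))
    (a : A ⟶ X.obj α) (y : T ⟶ Y.obj α) (b : MatchingFamily W₁ X α S T)
    (h₁ : a ≫ p.app α = l ≫ y)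
    (h₂ : ∀ ⦃β : C⦄ (σ : α ⟶ β) (hσ : S σ), a ≫ X.map σ = l ≫ b.map σ hσ)
    (h₃ : ∀ ⦃β : C⦄ (σ : α ⟶ β) (hσ : S σ), b.map σ hσ ≫ p.app β = y ≫ Y.map σ) :
    ∃ w : T ⟶ X.obj α, l ≫ w = a ∧ w ≫ p.app α = y ∧
      ∀ ⦃β : C⦄ (σ : α ⟶ β) (hσ : S σ), w ≫ X.map σ = b.map σ hσ := by
  -- Extend to all inverse maps out of α. Such a family is determined by its value at the identity,
  -- which is the desired lift.
  obtain ⟨w, w₁, w₂, w₃⟩ := MatchingFamily.exists_extension (r := r) p l (S := S)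
    (S' := fun β σ => W₁ σ) (fun _ _ h => h) hS' hS (fun _ _ σ τ => W₁.comp_mem σ τ)
    (fun _ _ _ _ => hp _) (.ofHom _ a) (.ofHom _ y) b
    (fun β σ hσ => by simp [← reassoc_of% h₁]) h₂ h₃
  refine ⟨w.map (𝟙 α) (W₁.id_mem α), ?_, ?_, fun β σ hσ => ?_⟩
  · simp [w₁]
  · simp [w₂]
  · rw [← w₃, w.comp _ _ _ _ _ (hS' σ hσ) (Category.id_comp σ)]

lemma hasLiftingProperty_app_of_matchingLift {X Y : C ⥤ M} (p : X ⟶ Y) {A T : M} (l : A ⟶ T)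
    (hp : ∀ β : C, MatchingLift r p β l) (α : C) : HasLiftingProperty l (p.app α) where
  sq_hasLift {a y} sq := by
    obtain ⟨w, w₁, w₂, -⟩ := exists_lift_of_matchingLift (r := r) p l hp
      (S := fun _ (_ : α ⟶ _) => False) (fun _ _ h => h.elim) (fun _ _ _ _ h => h.elim) a y
      ⟨fun _ h => h.elim, fun _ _ _ h => h.elim⟩ sq.w (fun _ _ h => h.elim) (fun _ _ h => h.elim)
    exact ⟨⟨⟨w, w₁, w₂⟩⟩⟩

/-- Extension from the empty class to all lowering maps. Only objects of degree below that of α are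
used, which permits induction on the degree in `relativeMatching_trivialFibrations`. -/
lemma hasLiftingProperty_matchingObjMap [HasLimitsOfSize.{0, 0} M] {X Y : C ⥤ M} (p : X ⟶ Y)
    {A T : M} (l : A ⟶ T) (α : C) (hp : ∀ β : C, r.deg β < r.deg α → MatchingLift r p β l) :
    HasLiftingProperty l (matchingObjMap W₁ p α) where
  sq_hasLift {a y} sq := by
    obtain ⟨w, w₁, w₂, -⟩ := MatchingFamily.exists_extension (r := r) p l
      (S := fun _ (_ : α ⟶ _) => False) (S' := Lowering r α) (fun _ _ h => h.1)
      (fun _ _ h => h.elim) (fun _ _ _ _ h => h.elim) (fun _ _ _ _ h => h.comp)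
      (fun β σ h _ => hp β h.2) (matchingFamilyOfHom a) (matchingFamilyOfHom y)
      ⟨fun _ h => h.elim, fun _ _ _ h => h.elim⟩
      (fun β σ hσ => by
        simpa using sq.w =≫ matchingπ Y σ hσ) (fun _ _ h => h.elim) (fun _ _ h => h.elim)
    refine ⟨⟨⟨w.lift, ?_, ?_⟩⟩⟩
    · exact matchingObj_hom_ext r fun β σ hσ => by simp [w₁]
    · exact matchingObj_hom_ext r fun β σ hσ => by simp [w₂]

/-- If the relative latching maps of `i` have the left lifting property with respect to `q`,
then so do the components of `i`. -/
lemma hasLiftingProperty_app_of_latchingLift {X Y : C ⥤ M} (i : X ⟶ Y) {E B : M} (q : E ⟶ B)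
    (hi : ∀ β : C, LatchingLift r i β q) (α : C) : HasLiftingProperty (i.app α) q where
  sq_hasLift {x y} sq := by
    classical
    have key : ∀ d : ℕ, ∃ e : LatchingFamily W₂ Y α (fun β δ => W₂ δ ∧ r.deg β < d) E,
        (∀ ⦃β : C⦄ (δ : β ⟶ α) hδ, i.app β ≫ e.map δ hδ = X.map δ ≫ x) ∧
        (∀ ⦃β : C⦄ (δ : β ⟶ α) hδ, e.map δ hδ ≫ q = Y.map δ ≫ y) := by
      intro d
      induction d with
      | zero => exact ⟨⟨fun δ hδ => (Nat.not_lt_zero _ hδ.2).elim,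
          fun _ _ _ hδ => (Nat.not_lt_zero _ hδ.2).elim⟩,
          fun _ _ hδ => (Nat.not_lt_zero _ hδ.2).elim, fun _ _ hδ => (Nat.not_lt_zero _ hδ.2).elim⟩
      | succ d ih =>
        obtain ⟨e, e₁, e₂⟩ := ih
        have hτ' : ∀ ⦃β γ : C⦄ (δ : β ⟶ α) (τ : γ ⟶ β), W₂ δ → r.deg β = d → Raising r β τ →
            W₂ (τ ≫ δ) ∧ r.deg γ < d := fun β γ δ τ hδ hβ hτ =>
          ⟨W₂.comp_mem τ δ hτ.1 hδ, hβ ▸ hτ.2⟩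
        have step : ∀ ⦃β : C⦄ (δ : β ⟶ α) (hδ : W₂ δ) (hβ : r.deg β = d),
            ∃ c : Y.obj β ⟶ E, i.app β ≫ c = X.map δ ≫ x ∧ c ≫ q = Y.map δ ≫ y ∧
              ∀ ⦃γ : C⦄ (τ : γ ⟶ β) (hτ : Raising r β τ),
                Y.map τ ≫ c = e.map (τ ≫ δ) (hτ' δ τ hδ hβ hτ) := by
          intro β δ hδ hβ
          refine hi β (X.map δ ≫ x) (Y.map δ ≫ y)
            ⟨fun τ hτ => e.map (τ ≫ δ) (hτ' δ τ hδ hβ hτ), fun τ τ' ρ hτ hρ h h' =>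
              e.comp _ _ _ _ _ h (by rw [← Category.assoc, h'])⟩ ?_ ?_ ?_
          · simp [sq.w]
          · intro γ τ hτ
            simp [e₁]
          · intro γ τ hτ
            simp [e₂]
        choose c c₁ c₂ c₃ using step
        have aux : ∀ ⦃β : C⦄, r.deg β < d + 1 → ¬ r.deg β < d → r.deg β = d := by lia
        refine ⟨⟨fun {β} δ hδ => if h : r.deg β < d then e.map δ ⟨hδ.1, h⟩ else
          c δ hδ.1 (aux hδ.2 h), ?_⟩, ?_, ?_⟩
        · intro β γ δ τ ρ hδ hρ hτ h
          subst h
          by_cases hδ' : r.deg β < d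
          · rw [dif_pos hδ', dif_pos ((r.le₂ τ hτ).trans_lt hδ')]
            exact e.comp _ _ _ _ _ hτ rfl
          · have hβ := aux hδ.2 hδ'
            by_cases hγ : r.deg γ < r.deg β
            · rw [dif_neg hδ', dif_pos (hβ ▸ hγ)]
              exact c₃ δ hδ.1 _ τ ⟨hτ, hγ⟩
            · obtain ⟨⟩ := r.identities_of_prop₂_of_eq hτ
                (le_antisymm (r.le₂ τ hτ) (not_lt.1 hγ))
              simp
        · intro β δ hδ
          dsimp only
          split_ifs
          exacts [e₁ _ _, c₁ _ _ _]
        · intro β δ hδ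
          dsimp only
          split_ifs
          exacts [e₂ _ _, c₂ _ _ _]
    obtain ⟨e, e₁, e₂⟩ := key (r.deg α + 1)
    exact ⟨⟨⟨e.map (𝟙 α) ⟨W₂.id_mem α, Nat.lt_succ_self _⟩, by simp [e₁], by simp [e₂]⟩⟩⟩

end Extension

/-! ### Lifting -/

section Lifting

variable {C : Type} [Category.{0} C] {M : Type u} [Category.{v} M]
  {W₁ W₂ : MorphismProperty C} [W₁.IsMultiplicative] [W₂.IsMultiplicative]
  (r : ReedyStructure W₁ W₂ ℕ) {A B X Y : C ⥤ M} {i : A ⟶ B} {p : X ⟶ Y} {u : A ⟶ X} {v : B ⟶ Y}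

/-- A lift in a square of diagrams, defined on the objects of degree less than `d`. -/
structure PartialLift (sq : CommSq u i p v) (d : ℕ) where
  app : ∀ α : C, r.deg α < d → (B.obj α ⟶ X.obj α)
  fac_left : ∀ (α : C) (hα : r.deg α < d), i.app α ≫ app α hα = u.app α
  fac_right : ∀ (α : C) (hα : r.deg α < d), app α hα ≫ p.app α = v.app α
  naturality : ∀ {α β : C} (f : α ⟶ β) (hα : r.deg α < d) (hβ : r.deg β < d),
    app α hα ≫ X.map f = B.map f ≫ app β hβ

variable {r} [HasLimitsOfSize.{0, 0} M] [HasColimitsOfSize.{0, 0} M] [HasPullbacks M]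
  [HasPushouts M]

/-- The partial lift induces a map from `B.obj α` to the matching object of X and one from the
latching object of B to `X.obj α`. A value at α compatible with both is a diagonal of the resulting
square from the relative latching map to the relative matching map. -/
lemma PartialLift.exists_app {sq : CommSq u i p v} {d : ℕ} (h : PartialLift r sq d) {α : C}
    (H : HasLiftingProperty (relativeLatchingMap W₂ i α) (relativeMatchingMap W₁ p α))
    (hα : r.deg α = d) :
    ∃ c : B.obj α ⟶ X.obj α, i.app α ≫ c = u.app α ∧ c ≫ p.app α = v.app α ∧
      (∀ ⦃β : C⦄ (σ : α ⟶ β) (hσ : Lowering r α σ),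
        c ≫ X.map σ = B.map σ ≫ h.app β (hα ▸ hσ.2)) ∧
      (∀ ⦃β : C⦄ (δ : β ⟶ α) (hδ : Raising r α δ),
        B.map δ ≫ c = h.app β (hα ▸ hδ.2) ≫ X.map δ) := by
  let b : MatchingFamily W₁ X α (Lowering r α) (B.obj α) :=
    ⟨fun {β} σ hσ => B.map σ ≫ h.app β (hα ▸ hσ.2), fun σ τ ρ hσ hρ hτ e => by
      subst e
      rw [Category.assoc, h.naturality τ (hα ▸ hσ.2) (hα ▸ hρ.2), B.map_comp, Category.assoc]⟩
  let e : LatchingFamily W₂ B α (Raising r α) (X.obj α) :=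
    ⟨fun {β} δ hδ => h.app β (hα ▸ hδ.2) ≫ X.map δ, fun δ τ ρ hδ hρ hτ e => by
      subst e
      rw [← Category.assoc, ← h.naturality τ (hα ▸ hρ.2) (hα ▸ hδ.2), X.map_comp,
        Category.assoc]⟩
  obtain ⟨t, t₁, t₂⟩ : ∃ t : B.obj α ⟶ pullback (matchingMap W₁ Y α) (matchingObjMap W₁ p α),
      t ≫ pullback.fst _ _ = v.app α ∧ t ≫ pullback.snd _ _ = b.lift :=
    ⟨pullback.lift (v.app α) b.lift (matchingObj_hom_ext r fun β σ hσ => by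
      simp [b, h.fac_right]), pullback.lift_fst _ _ _, pullback.lift_snd _ _ _⟩
  have h₁ : u.app α ≫ relativeMatchingMap W₁ p α = i.app α ≫ t := by
    apply pullback.hom_ext
    · simpa [t₁] using congr_app sq.w α
    · refine matchingObj_hom_ext r fun β σ hσ => ?_
      simp [reassoc_of% t₂, b, ← reassoc_of% i.naturality, h.fac_left]
  have h₂ : ∀ ⦃β : C⦄ (δ : β ⟶ α) (hδ : Raising r α δ),
      A.map δ ≫ u.app α = i.app β ≫ e.map δ hδ := by
    intro β δ hδ
    simp [e, ← h.fac_left β (hα ▸ hδ.2)]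
  have h₃ : ∀ ⦃β : C⦄ (δ : β ⟶ α) (hδ : Raising r α δ),
      e.map δ hδ ≫ relativeMatchingMap W₁ p α = B.map δ ≫ t := by
    intro β δ hδ
    apply pullback.hom_ext
    · simp [t₁, e, reassoc_of% h.fac_right]
    · refine matchingObj_hom_ext r fun γ σ hσ => ?_
      -- The square commutes on mixed terms because δ ≫ σ passes through α but has both ends in
      -- degree below d, where naturality is known.
      simpa [reassoc_of% t₂, b, e] using h.naturality (δ ≫ σ) (hα ▸ hδ.2) (hα ▸ hσ.2)
  obtain ⟨c, c₁, c₂, c₃⟩ := (hasLiftingProperty_relativeLatchingMap_iff r i α _).1 H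
    (u.app α) t e h₁ h₂ h₃
  refine ⟨c, c₁, ?_, fun β σ hσ => ?_, fun β δ hδ => c₃ δ hδ⟩
  · rw [← t₁, ← c₂, Category.assoc, relativeMatchingMap_fst]
  · rw [show B.map σ ≫ h.app β (hα ▸ hσ.2) = b.map σ hσ from rfl, ← b.lift_π, ← t₂, ← c₂]
    simp only [Category.assoc, relativeMatchingMap_snd_assoc, matchingMap_matchingπ]

lemma PartialLift.exists_succ {sq : CommSq u i p v} {d : ℕ} (h : PartialLift r sq d)
    (H : ∀ α, HasLiftingProperty (relativeLatchingMap W₂ i α) (relativeMatchingMap W₁ p α)) :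
    ∃ h' : PartialLift r sq (d + 1), ∀ (α : C) (hα : r.deg α < d) (hα' : r.deg α < d + 1),
      h'.app α hα' = h.app α hα := by
  classical
  choose c c₁ c₂ c₃ c₄ using fun (α : C) (hα : r.deg α = d) => h.exists_app (H α) hα
  have aux : ∀ {α : C}, r.deg α < d + 1 → ¬ r.deg α < d → r.deg α = d := by lia
  let app (α : C) (hα : r.deg α < d + 1) : B.obj α ⟶ X.obj α :=
    if hα' : r.deg α < d then h.app α hα' else c α (aux hα hα')
  have nat₁ : ∀ {α β : C} (f : α ⟶ β) (_ : W₁ f) (hα : r.deg α < d + 1) (hβ : r.deg β < d + 1),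
      app α hα ≫ X.map f = B.map f ≫ app β hβ := by
    intro α β f hf hα hβ
    dsimp only [app]
    by_cases hα' : r.deg α < d
    · rw [dif_pos hα', dif_pos ((r.le₁ f hf).trans_lt hα'), h.naturality]
    · have hd := aux hα hα'
      by_cases hβ' : r.deg β < r.deg α
      · rw [dif_neg hα', dif_pos (hd ▸ hβ'), c₃ α hd f ⟨hf, hβ'⟩]
      · obtain ⟨⟩ := r.identities_of_prop₁_of_eq hf (le_antisymm (not_lt.1 hβ') (r.le₁ f hf))
        simp
  have nat₂ : ∀ {α β : C} (f : α ⟶ β) (_ : W₂ f) (hα : r.deg α < d + 1) (hβ : r.deg β < d + 1),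
      app α hα ≫ X.map f = B.map f ≫ app β hβ := by
    intro α β f hf hα hβ
    dsimp only [app]
    by_cases hβ' : r.deg β < d
    · rw [dif_pos hβ', dif_pos ((r.le₂ f hf).trans_lt hβ'), h.naturality]
    · have hd := aux hβ hβ'
      by_cases hα' : r.deg α < r.deg β
      · rw [dif_neg hβ', dif_pos (hd ▸ hα'), c₄ β hd f ⟨hf, hα'⟩]
      · obtain ⟨⟩ := r.identities_of_prop₂_of_eq hf (le_antisymm (r.le₂ f hf) (not_lt.1 hα'))
        simp
  refine ⟨⟨app, ?_, ?_, ?_⟩, fun α hα hα' => dif_pos hα⟩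
  · intro α hα
    dsimp only [app]
    split_ifs
    exacts [h.fac_left _ _, c₁ _ _]
  · intro α hα
    dsimp only [app]
    split_ifs
    exacts [h.fac_right _ _, c₂ _ _]
  · intro α β f hα hβ
    -- Naturality for inverse and for direct maps suffices, since the middle object of the
    -- factorization also has degree below d + 1.
    obtain ⟨Z, σ, δ, hσ, hδ, rfl, -⟩ := r.exists_fac f
    have hZ := (r.le₁ σ hσ).trans_lt hα
    simp only [Functor.map_comp, reassoc_of% nat₁ σ hσ hα hZ, nat₂ δ hδ hZ hβ, Category.assoc]

/-- A map of diagrams has the left lifting property with respect to another one if its relative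
latching maps have the left lifting property with respect to the relative matching maps. -/
lemma hasLiftingProperty_of_relative (r : ReedyStructure W₁ W₂ ℕ) (i : A ⟶ B) (p : X ⟶ Y)
    (H : ∀ α, HasLiftingProperty (relativeLatchingMap W₂ i α) (relativeMatchingMap W₁ p α)) :
    HasLiftingProperty i p where
  sq_hasLift {u v} sq := by
    choose next h_next using fun (d : ℕ) (h : PartialLift r sq d) => h.exists_succ H
    let seq : ∀ d, PartialLift r sq d := fun d => Nat.rec
      ⟨fun α hα => (Nat.not_lt_zero _ hα).elim, fun α hα => (Nat.not_lt_zero _ hα).elim,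
        fun α hα => (Nat.not_lt_zero _ hα).elim, fun f hα => (Nat.not_lt_zero _ hα).elim⟩ next d
    have h_seq : ∀ (d e : ℕ), d ≤ e → ∀ (α : C) (hα : r.deg α < d) (hα' : r.deg α < e),
        (seq e).app α hα' = (seq d).app α hα := by
      intro d e hde
      induction e, hde using Nat.le_induction with
      | base => exact fun _ _ _ => rfl
      | succ e hde ih =>
        exact fun α hα hα' => (h_next e (seq e) α (hα.trans_le hde) hα').trans (ih α hα _)
    refine ⟨⟨⟨
      { app := fun α => (seq (r.deg α + 1)).app α (Nat.lt_succ_self _)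
        naturality := fun α β f => ?_ }, ?_, ?_⟩⟩⟩
    · have hα := Nat.lt_succ_of_le (le_max_left (r.deg α) (r.deg β))
      have hβ := Nat.lt_succ_of_le (le_max_right (r.deg α) (r.deg β))
      rw [← h_seq _ (max (r.deg α) (r.deg β) + 1) hα _ _ hα,
        ← h_seq _ (max (r.deg α) (r.deg β) + 1) hβ _ _ hβ, (seq _).naturality f hα hβ]
    · ext α
      exact (seq (r.deg α + 1)).fac_left α (Nat.lt_succ_self _)
    · ext α
      exact (seq (r.deg α + 1)).fac_right α (Nat.lt_succ_self _)

end Lifting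

/-! ### Attaching cells to a diagram -/

section Cells

variable {C : Type} [Category.{0} C] {M : Type u} [Category.{v} M]
  {W₁ W₂ : MorphismProperty C} [W₁.IsMultiplicative] [W₂.IsMultiplicative]
  {r : ReedyStructure W₁ W₂ ℕ} {X Y : C ⥤ M}

variable (r) in
/-- Factorizations `X_α ⟶ N_α ⟶ Y_α ×_{M_α Y} M_α X` of the relative matching maps of `p`. -/
structure CellData (p : X ⟶ Y) where
  N : C → M
  l (α : C) : X.obj α ⟶ N α
  y (α : C) : N α ⟶ Y.obj α
  m (α : C) : MatchingFamily W₁ X α (Lowering r α) (N α)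
  l_y (α : C) : l α ≫ y α = p.app α
  l_m {α β : C} (σ : α ⟶ β) (hσ : Lowering r α σ) : l α ≫ (m α).map σ hσ = X.map σ
  m_app {α β : C} (σ : α ⟶ β) (hσ : Lowering r α σ) : (m α).map σ hσ ≫ p.app β = y α ≫ Y.map σ

lemma lowering_of_not_prop₂ {α γ : C} {g : α ⟶ γ} (hg : ¬ W₂ g)
    (F : W₁.MapFactorizationData W₂ g) : Lowering r α F.i :=
  ⟨F.hi, lt_of_le_of_ne (r.le₁ F.i F.hi) fun h =>
    hg (r.prop₂_of_degHom_eq_deg_left ((r.degHom_eq F).trans h))⟩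

/-- The degree of the object through which a map factors can only drop under postcomposition, and it
equals the degree of the source exactly for direct maps. -/
lemma not_prop₂_comp (r : ReedyStructure W₁ W₂ ℕ) {α γ γ' : C} {g : α ⟶ γ} (hg : ¬ W₂ g)
    (f : γ ⟶ γ') : ¬ W₂ (g ≫ f) := by
  intro h
  refine hg (r.prop₂_of_degHom_eq_deg_left (le_antisymm (r.degHom_le_deg_left g) ?_))
  have := r.degHom_eq (f := g ≫ f)
    ⟨α, 𝟙 α, g ≫ f, Category.id_comp _, W₁.id_mem α, h⟩
  exact this.symm.trans_le (r.degHom_comp_le_left g f)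

lemma Lowering.not_prop₂ {α β : C} {σ : α ⟶ β} (hσ : Lowering r α σ) : ¬ W₂ σ :=
  fun h => (r.le₂ σ h).not_gt hσ.2

/-! ### Gluing the cells of one degree to a diagram -/

namespace CellData

variable {p : X ⟶ Y} (c : CellData r p)

/-- The map `N_α ⟶ X_γ` induced by a map `α ⟶ γ` which is not in the direct subcategory. -/
def via {α γ : C} (g : α ⟶ γ) (hg : ¬ W₂ g) : c.N α ⟶ X.obj γ :=
  (c.m α).map (r.mapFactorizationData g).i (lowering_of_not_prop₂ hg _) ≫
    X.map (r.mapFactorizationData g).p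

/-- Reedy factorizations are unique, so any of them computes `via`. This is what makes `via`
functorial in the target, and hence attaching cells a functor even though δ ≫ f may leave the direct
subcategory. -/
lemma via_eq {α β γ : C} (σ : α ⟶ β) (δ : β ⟶ γ) (hσ : Lowering r α σ) (hδ : W₂ δ)
    (hg : ¬ W₂ (σ ≫ δ)) : c.via (σ ≫ δ) hg = (c.m α).map σ hσ ≫ X.map δ := by
  have (F F' : W₁.MapFactorizationData W₂ (σ ≫ δ)) (h : Lowering r α F.i)
      (h' : Lowering r α F'.i) :
      (c.m α).map F.i h ≫ X.map F.p = (c.m α).map F'.i h' ≫ X.map F'.p := by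
    have := r.subsingleton_mapFactorizationData (σ ≫ δ)
    obtain rfl := Subsingleton.elim F F'
    rfl
  exact this _ ⟨β, σ, δ, rfl, hσ.1, hδ⟩ _ hσ

lemma via_eq_map {α β : C} (σ : α ⟶ β) (hσ : Lowering r α σ) :
    c.via σ hσ.not_prop₂ = (c.m α).map σ hσ := by
  have hσ' := hσ.not_prop₂
  rw [← Category.comp_id σ] at hσ'
  have := c.via_eq σ (𝟙 β) hσ (W₂.id_mem β) hσ'
  simpa using this

lemma via_map {α γ γ' : C} (g : α ⟶ γ) (hg : ¬ W₂ g) (f : γ ⟶ γ') (hgf : ¬ W₂ (g ≫ f)) :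
    c.via g hg ≫ X.map f = c.via (g ≫ f) hgf := by
  let F := r.mapFactorizationData g
  have hF : Lowering r α F.i := lowering_of_not_prop₂ hg F
  let F' := r.mapFactorizationData (F.p ≫ f)
  have fac : g ≫ f = (F.i ≫ F'.i) ≫ F'.p := by
    rw [Category.assoc, F'.fac, ← Category.assoc, F.fac]
  have : c.via (g ≫ f) hgf = c.via ((F.i ≫ F'.i) ≫ F'.p) (fac ▸ hgf) := by
    congr
  rw [this, c.via_eq _ _ (hF.comp F'.hi) F'.hp, ← (c.m α).comp F.i F'.i _ hF _ F'.hi rfl,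
    Category.assoc, ← X.map_comp, F'.fac, X.map_comp, ← Category.assoc]
  rfl

lemma l_via {α γ : C} (g : α ⟶ γ) (hg : ¬ W₂ g) : c.l α ≫ c.via g hg = X.map g := by
  rw [via, ← Category.assoc, c.l_m, ← X.map_comp, MorphismProperty.MapFactorizationData.fac]

lemma via_app {α γ : C} (g : α ⟶ γ) (hg : ¬ W₂ g) :
    c.via g hg ≫ p.app γ = c.y α ≫ Y.map g := by
  rw [via, Category.assoc, p.naturality, ← Category.assoc, c.m_app, Category.assoc, ← Y.map_comp,
    MorphismProperty.MapFactorizationData.fac]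

variable [HasColimitsOfSize.{0, 0} M] (d : ℕ)

variable (W₂) (r) in
/-- The cells of degree `d` attached at the object `γ`. -/
abbrev Index (γ : C) : Type :=
  { x : Σ α : C, (α ⟶ γ) // r.deg x.1 = d ∧ W₂ x.2 }

/-- The inclusion of the boundaries of the cells of degree `d`. -/
abbrev cellBoundary (γ : C) :
    (∐ fun x : Index W₂ r d γ => X.obj x.1.1) ⟶ ∐ fun x : Index W₂ r d γ => c.N x.1.1 :=
  Limits.Sigma.map fun x => c.l x.1.1

variable (X r) in
/-- The attaching map of the cells of degree `d`. -/
abbrev cellAttach (γ : C) : (∐ fun x : Index W₂ r d γ => X.obj x.1.1) ⟶ X.obj γ :=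
  Limits.Sigma.desc fun x => X.map x.1.2

variable [HasPushouts M]

/-- The object `X_γ` with the cells of degree `d` attached. -/
def attachObj (γ : C) : M := pushout (cellAttach r X d γ) (c.cellBoundary d γ)

/-- The inclusion of `X_γ`. -/
def inl (γ : C) : X.obj γ ⟶ c.attachObj d γ := pushout.inl _ _

variable {d} in
/-- The inclusion of a cell. -/
def cell {α γ : C} (δ : α ⟶ γ) (hα : r.deg α = d) (hδ : W₂ δ) : c.N α ⟶ c.attachObj d γ :=
  Limits.Sigma.ι (fun x : Index W₂ r d γ => c.N x.1.1) ⟨⟨α, δ⟩, hα, hδ⟩ ≫ pushout.inr _ _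

lemma l_cell {α γ : C} (δ : α ⟶ γ) (hα : r.deg α = d) (hδ : W₂ δ) :
    c.l α ≫ c.cell δ hα hδ = X.map δ ≫ c.inl d γ := by
  have := Limits.Sigma.ι (fun x : Index W₂ r d γ => X.obj x.1.1) ⟨⟨α, δ⟩, hα, hδ⟩ ≫=
    pushout.condition (f := cellAttach r X d γ) (g := c.cellBoundary d γ)
  rw [Limits.Sigma.ι_desc_assoc, Limits.Sigma.ι_map_assoc] at this
  exact this.symm

variable {d}

lemma attachObj_hom_ext {γ : C} {T : M} {f g : c.attachObj d γ ⟶ T}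
    (h : c.inl d γ ≫ f = c.inl d γ ≫ g)
    (h' : ∀ ⦃α : C⦄ (δ : α ⟶ γ) (hα : r.deg α = d) (hδ : W₂ δ),
      c.cell δ hα hδ ≫ f = c.cell δ hα hδ ≫ g) : f = g := by
  refine pushout.hom_ext h (Limits.Sigma.hom_ext _ _ fun x => ?_)
  exact ((Category.assoc _ _ _).symm.trans (h' x.1.2 x.2.1 x.2.2)).trans (Category.assoc _ _ _)

lemma exists_desc {γ : C} {T : M} (x : X.obj γ ⟶ T)
    (k : ∀ (α : C) (δ : α ⟶ γ), r.deg α = d → W₂ δ → (c.N α ⟶ T))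
    (h : ∀ (α : C) (δ : α ⟶ γ) (hα : r.deg α = d) (hδ : W₂ δ),
      c.l α ≫ k α δ hα hδ = X.map δ ≫ x) :
    ∃ w : c.attachObj d γ ⟶ T, c.inl d γ ≫ w = x ∧
      ∀ (α : C) (δ : α ⟶ γ) (hα : r.deg α = d) (hδ : W₂ δ), c.cell δ hα hδ ≫ w = k α δ hα hδ := by
  have : cellAttach r X d γ ≫ x = c.cellBoundary d γ ≫
      Limits.Sigma.desc fun x : Index W₂ r d γ => k x.1.1 x.1.2 x.2.1 x.2.2 :=
    Limits.Sigma.hom_ext _ _ fun x => by simp [h]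
  refine ⟨pushout.desc x _ this, pushout.inl_desc _ _ _, fun α δ hα hδ => ?_⟩
  refine (Category.assoc _ _ _).trans ((congrArg (_ ≫ ·) (pushout.inr_desc _ _ this)).trans ?_)
  exact Limits.Sigma.ι_desc _ _

/-- The map out of `X_γ` with cells attached given by its restrictions to `X_γ` and the cells. -/
def desc {γ : C} {T : M} (x : X.obj γ ⟶ T)
    (k : ∀ (α : C) (δ : α ⟶ γ), r.deg α = d → W₂ δ → (c.N α ⟶ T))
    (h : ∀ (α : C) (δ : α ⟶ γ) (hα : r.deg α = d) (hδ : W₂ δ),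
      c.l α ≫ k α δ hα hδ = X.map δ ≫ x) :
    c.attachObj d γ ⟶ T :=
  (c.exists_desc x k h).choose

@[simp]
lemma inl_desc {γ : C} {T : M} (x : X.obj γ ⟶ T)
    (k : ∀ (α : C) (δ : α ⟶ γ), r.deg α = d → W₂ δ → (c.N α ⟶ T))
    (h : ∀ (α : C) (δ : α ⟶ γ) (hα : r.deg α = d) (hδ : W₂ δ),
      c.l α ≫ k α δ hα hδ = X.map δ ≫ x) :
    c.inl d γ ≫ c.desc x k h = x :=
  (c.exists_desc x k h).choose_spec.1

@[simp]
lemma cell_desc {γ : C} {T : M} (x : X.obj γ ⟶ T)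
    (k : ∀ (α : C) (δ : α ⟶ γ), r.deg α = d → W₂ δ → (c.N α ⟶ T))
    (h : ∀ (α : C) (δ : α ⟶ γ) (hα : r.deg α = d) (hδ : W₂ δ),
      c.l α ≫ k α δ hα hδ = X.map δ ≫ x)
    {α : C} (δ : α ⟶ γ) (hα : r.deg α = d) (hδ : W₂ δ) :
    c.cell δ hα hδ ≫ c.desc x k h = k α δ hα hδ :=
  (c.exists_desc x k h).choose_spec.2 α δ hα hδ

open Classical in
/-- The map from `N_α` induced by an arbitrary map `α ⟶ γ`. -/
def ofHom {α γ : C} (g : α ⟶ γ) (hα : r.deg α = d) : c.N α ⟶ c.attachObj d γ :=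
  if hg : W₂ g then c.cell g hα hg else c.via g hg ≫ c.inl d γ

lemma ofHom_eq_cell {α γ : C} (δ : α ⟶ γ) (hα : r.deg α = d) (hδ : W₂ δ) :
    c.ofHom δ hα = c.cell δ hα hδ :=
  dif_pos hδ

lemma ofHom_eq_via {α γ : C} (g : α ⟶ γ) (hα : r.deg α = d) (hg : ¬ W₂ g) :
    c.ofHom g hα = c.via g hg ≫ c.inl d γ :=
  dif_neg hg

lemma l_ofHom {α γ : C} (g : α ⟶ γ) (hα : r.deg α = d) :
    c.l α ≫ c.ofHom g hα = X.map g ≫ c.inl d γ := by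
  by_cases hg : W₂ g
  · rw [c.ofHom_eq_cell g hα hg, l_cell]
  · rw [c.ofHom_eq_via g hα hg, ← Category.assoc, l_via]

/-- The functoriality of attaching cells. -/
def attachMap {γ γ' : C} (f : γ ⟶ γ') : c.attachObj d γ ⟶ c.attachObj d γ' :=
  c.desc (X.map f ≫ c.inl d γ') (fun _ δ hα _ => c.ofHom (δ ≫ f) hα)
    fun _ δ hα _ => by rw [l_ofHom, X.map_comp, Category.assoc]

@[simp]
lemma inl_attachMap {γ γ' : C} (f : γ ⟶ γ') :
    c.inl d γ ≫ c.attachMap f = X.map f ≫ c.inl d γ' :=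
  c.inl_desc _ _ _

@[simp]
lemma inl_attachMap_assoc {γ γ' : C} (f : γ ⟶ γ') {T : M} (h : c.attachObj d γ' ⟶ T) :
    c.inl d γ ≫ c.attachMap f ≫ h = X.map f ≫ c.inl d γ' ≫ h := by
  simp only [← Category.assoc, inl_attachMap]

@[simp]
lemma ofHom_attachMap {α γ γ' : C} (g : α ⟶ γ) (hα : r.deg α = d) (f : γ ⟶ γ') :
    c.ofHom g hα ≫ c.attachMap f = c.ofHom (g ≫ f) hα := by
  by_cases hg : W₂ g
  · rw [c.ofHom_eq_cell g hα hg]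
    exact c.cell_desc _ _ _ _ _ _
  · rw [c.ofHom_eq_via g hα hg, c.ofHom_eq_via _ hα (not_prop₂_comp r hg f), Category.assoc,
      inl_attachMap, ← Category.assoc, c.via_map]

@[simp]
lemma ofHom_attachMap_assoc {α γ γ' : C} (g : α ⟶ γ) (hα : r.deg α = d) (f : γ ⟶ γ') {T : M}
    (h : c.attachObj d γ' ⟶ T) :
    c.ofHom g hα ≫ c.attachMap f ≫ h = c.ofHom (g ≫ f) hα ≫ h := by
  simp only [← Category.assoc (c.ofHom g hα), ofHom_attachMap]

variable (d) in
/-- The diagram `X` with the cells of degree `d` attached. -/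
def attach : C ⥤ M where
  obj := c.attachObj d
  map f := c.attachMap f
  map_id γ := by
    apply c.attachObj_hom_ext
    · simp
    · intro α δ hα hδ
      simp [← c.ofHom_eq_cell δ hα hδ]
  map_comp f f' := by
    apply c.attachObj_hom_ext
    · simp
    · intro α δ hα hδ
      simp [← c.ofHom_eq_cell δ hα hδ]

variable (d) in
/-- The inclusion of `X` into the diagram with cells attached. -/
def ι : X ⟶ c.attach d where
  app γ := c.inl d γ
  naturality _ _ f := (c.inl_attachMap f).symm

/-- The map from `N_α` to the diagram with cells attached induced by a map `α ⟶ γ`. -/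
def cellMap {α γ : C} (g : α ⟶ γ) (hα : r.deg α = d) : c.N α ⟶ (c.attach d).obj γ :=
  c.ofHom g hα

@[simp]
lemma cellMap_map {α γ γ' : C} (g : α ⟶ γ) (hα : r.deg α = d) (f : γ ⟶ γ') :
    c.cellMap g hα ≫ (c.attach d).map f = c.cellMap (g ≫ f) hα :=
  c.ofHom_attachMap g hα f

@[simp]
lemma cellMap_map_assoc {α γ γ' : C} (g : α ⟶ γ) (hα : r.deg α = d) (f : γ ⟶ γ') {T : M}
    (h : (c.attach d).obj γ' ⟶ T) :
    c.cellMap g hα ≫ (c.attach d).map f ≫ h = c.cellMap (g ≫ f) hα ≫ h := by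
  rw [← Category.assoc, cellMap_map]

lemma l_cellMap {α γ : C} (g : α ⟶ γ) (hα : r.deg α = d) :
    c.l α ≫ c.cellMap g hα = X.map g ≫ (c.ι d).app γ :=
  c.l_ofHom g hα

lemma l_cellMap_assoc {α γ : C} (g : α ⟶ γ) (hα : r.deg α = d) {T : M}
    (h : (c.attach d).obj γ ⟶ T) :
    c.l α ≫ c.cellMap g hα ≫ h = X.map g ≫ (c.ι d).app γ ≫ h := by
  rw [← Category.assoc, l_cellMap, Category.assoc]

lemma cellMap_eq_of_lowering {α γ : C} (σ : α ⟶ γ) (hα : r.deg α = d) (hσ : Lowering r α σ) :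
    c.cellMap σ hα = (c.m α).map σ hσ ≫ (c.ι d).app γ :=
  (c.ofHom_eq_via σ hα hσ.not_prop₂).trans (by rw [via_eq_map]; rfl)

lemma attach_hom_ext {γ : C} {T : M} {f g : (c.attach d).obj γ ⟶ T}
    (h : (c.ι d).app γ ≫ f = (c.ι d).app γ ≫ g)
    (h' : ∀ ⦃α : C⦄ (δ : α ⟶ γ) (hα : r.deg α = d) (_ : W₂ δ),
      c.cellMap δ hα ≫ f = c.cellMap δ hα ≫ g) : f = g :=
  c.attachObj_hom_ext h fun α δ hα hδ => by
    have := h' δ hα hδ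
    rwa [cellMap, c.ofHom_eq_cell δ hα hδ] at this

lemma exists_attach_desc {γ : C} {T : M} (x : X.obj γ ⟶ T)
    (k : ∀ (α : C) (δ : α ⟶ γ), r.deg α = d → W₂ δ → (c.N α ⟶ T))
    (h : ∀ (α : C) (δ : α ⟶ γ) (hα : r.deg α = d) (hδ : W₂ δ),
      c.l α ≫ k α δ hα hδ = X.map δ ≫ x) :
    ∃ w : (c.attach d).obj γ ⟶ T, (c.ι d).app γ ≫ w = x ∧
      ∀ (α : C) (δ : α ⟶ γ) (hα : r.deg α = d) (hδ : W₂ δ), c.cellMap δ hα ≫ w = k α δ hα hδ := by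
  obtain ⟨w, w₁, w₂⟩ := c.exists_desc x k h
  exact ⟨w, w₁, fun α δ hα hδ => by rw [cellMap, c.ofHom_eq_cell δ hα hδ]; exact w₂ α δ hα hδ⟩

variable (d) in
/-- The components of the map to `Y` from the diagram `X` with cells attached. -/
def toYApp (γ : C) : (c.attach d).obj γ ⟶ Y.obj γ :=
  c.desc (p.app γ) (fun α δ _ _ => c.y α ≫ Y.map δ) fun α δ _ _ => by
    rw [← Category.assoc, l_y, p.naturality]

lemma ι_app_toYApp (γ : C) : (c.ι d).app γ ≫ c.toYApp d γ = p.app γ :=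
  c.inl_desc _ _ _

lemma cellMap_toYApp {α γ : C} (g : α ⟶ γ) (hα : r.deg α = d) :
    c.cellMap g hα ≫ c.toYApp d γ = c.y α ≫ Y.map g := by
  by_cases h : W₂ g
  · rw [cellMap, c.ofHom_eq_cell _ hα h]
    exact c.cell_desc _ _ _ _ _ _
  · rw [cellMap, c.ofHom_eq_via _ hα h, ← c.via_app g h, ← c.ι_app_toYApp (d := d), ← Category.assoc]
    rfl

variable (d) in
/-- The map to `Y` from the diagram `X` with cells attached. -/
def toY : c.attach d ⟶ Y where
  app γ := c.toYApp d γ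
  naturality γ γ' f := by
    apply c.attach_hom_ext
    · rw [← NatTrans.naturality_assoc, ι_app_toYApp, ← Category.assoc, ι_app_toYApp, p.naturality]
    · intro α δ hα hδ
      rw [cellMap_map_assoc, cellMap_toYApp, ← Category.assoc, cellMap_toYApp, Y.map_comp,
        Category.assoc]

@[simp]
lemma ι_toY : c.ι d ≫ c.toY d = p := by
  ext γ
  exact c.ι_app_toYApp γ

@[simp]
lemma cellMap_toY {α γ : C} (g : α ⟶ γ) (hα : r.deg α = d) :
    c.cellMap g hα ≫ (c.toY d).app γ = c.y α ≫ Y.map g :=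
  c.cellMap_toYApp g hα

/-- No direct map goes from degree d to a smaller degree, so no cell is attached at γ. -/
lemma isIso_ι_app {γ : C} (hγ : r.deg γ < d) : IsIso ((c.ι d).app γ) := by
  have h : ∀ {α : C} (δ : α ⟶ γ), r.deg α = d → W₂ δ → False :=
    fun δ hα hδ => absurd (r.le₂ δ hδ) (by lia)
  obtain ⟨w, hw, -⟩ := c.exists_attach_desc (d := d) (𝟙 (X.obj γ))
    (fun _ δ hα hδ => (h δ hα hδ).elim) fun _ δ hα hδ => (h δ hα hδ).elim
  refine ⟨w, hw, c.attach_hom_ext ?_ fun α δ hα hδ => (h δ hα hδ).elim⟩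
  simp [reassoc_of% hw]

/-- Between objects of degree d the only direct maps are identities. Exactly one cell is attached at
γ, along the identity of `X.obj γ`, so the result is `c.N γ`. -/
lemma isIso_cellMap_id {γ : C} (hγ : r.deg γ = d) : IsIso (c.cellMap (𝟙 γ) hγ) := by
  have h : ∀ {α : C} (δ : α ⟶ γ), r.deg α = d → W₂ δ → MorphismProperty.identities C δ :=
    fun δ hα hδ => r.identities_of_prop₂_of_eq hδ (hα.trans hγ.symm)
  have h' : ∀ {α : C} (δ : α ⟶ γ), MorphismProperty.identities C δ → α = γ := by
    rintro α δ ⟨⟩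
    rfl
  obtain ⟨w, hw, hw'⟩ := c.exists_attach_desc (d := d) (c.l γ)
    (fun _ δ hα hδ => eqToHom (congrArg c.N (h' δ (h δ hα hδ)))) fun _ δ hα hδ => by
      obtain ⟨⟩ := h δ hα hδ
      simp
  have hw'' : c.cellMap (𝟙 γ) hγ ≫ w = 𝟙 _ := hw' γ (𝟙 γ) hγ (W₂.id_mem γ)
  refine ⟨w, hw'', c.attach_hom_ext ?_ fun α δ hα hδ => ?_⟩
  · simp [reassoc_of% hw, l_cellMap]
  · obtain ⟨⟩ := h δ hα hδ
    rw [reassoc_of% hw'', Category.comp_id]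

/-- Attaching cells whose boundary inclusions have the left lifting property with respect to `q`
yields a map whose relative latching maps have this property. -/
lemma latchingLift_ι {E B : M} (q : E ⟶ B) (hq : ∀ α, HasLiftingProperty (c.l α) q) (γ : C) :
    LatchingLift r (c.ι d) γ q := by
  intro x y e h₁ h₂ h₃
  have key : ∀ {α : C} (δ : α ⟶ γ) (hα : r.deg α = d) (hδ : W₂ δ),
      ∃ k : c.N α ⟶ E, c.l α ≫ k = X.map δ ≫ x ∧ k ≫ q = c.cellMap δ hα ≫ y ∧
        ∀ h : Raising r γ δ, k = c.cellMap (𝟙 α) hα ≫ e.map δ h := by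
    intro α δ hα hδ
    -- On cells coming from a lower degree the value is forced by the latching family e; on the
    -- remaining ones a lift against q is chosen.
    by_cases h : Raising r γ δ
    · refine ⟨c.cellMap (𝟙 α) hα ≫ e.map δ h, ?_, ?_, fun _ => rfl⟩
      · rw [l_cellMap_assoc, h₂ δ h, X.map_id, Category.id_comp]
      · rw [Category.assoc, h₃, cellMap_map_assoc, Category.id_comp]
    · have sq : CommSq (X.map δ ≫ x) (c.l α) q (c.cellMap δ hα ≫ y) := ⟨by
        rw [Category.assoc, h₁, l_cellMap_assoc]⟩
      exact ⟨sq.lift, sq.fac_left, sq.fac_right, fun h' => (h h').elim⟩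
  choose k k₁ k₂ k₃ using @key
  obtain ⟨w, w₁, w₂⟩ := c.exists_attach_desc x (fun _ δ hα hδ => k δ hα hδ)
    (fun _ δ hα hδ => k₁ δ hα hδ)
  refine ⟨w, w₁, c.attach_hom_ext ?_ fun α δ hα hδ => ?_,
    fun β δ hδ => c.attach_hom_ext ?_ fun α δ' hα hδ' => ?_⟩
  · rw [← Category.assoc, w₁, h₁]
  · rw [← Category.assoc, w₂ α δ hα hδ, k₂]
  · rw [← NatTrans.naturality_assoc, w₁, h₂ δ hδ]
  · have hc := hδ.comp hδ'
    rw [cellMap_map_assoc, w₂ _ _ hα hc.1, k₃ _ _ _ hc, ← e.comp δ δ' _ hδ hc hδ' rfl,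
      cellMap_map_assoc, Category.id_comp]

/-- After attaching the cells of degree `d`, the relative matching maps at the objects of
degree `d` are the given maps `N_γ ⟶ Y_γ ×_{M_γ Y} M_γ X`. -/
lemma matchingLift_toY {γ : C} (hγ : r.deg γ = d) {A T : M} (l : A ⟶ T)
    (H : ∀ (a : A ⟶ c.N γ) (y : T ⟶ Y.obj γ) (b : MatchingFamily W₁ X γ (Lowering r γ) T),
      a ≫ c.y γ = l ≫ y →
      (∀ ⦃β : C⦄ (σ : γ ⟶ β) (hσ : Lowering r γ σ), a ≫ (c.m γ).map σ hσ = l ≫ b.map σ hσ) →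
      (∀ ⦃β : C⦄ (σ : γ ⟶ β) (hσ : Lowering r γ σ), b.map σ hσ ≫ p.app β = y ≫ Y.map σ) →
      ∃ w : T ⟶ c.N γ, l ≫ w = a ∧ w ≫ c.y γ = y ∧
        ∀ ⦃β : C⦄ (σ : γ ⟶ β) (hσ : Lowering r γ σ), w ≫ (c.m γ).map σ hσ = b.map σ hσ) :
    MatchingLift r (c.toY d) γ l := by
  intro a y b h₁ h₂ h₃
  have := c.isIso_cellMap_id hγ
  have hi : ∀ ⦃β : C⦄ (σ : γ ⟶ β), Lowering r γ σ → IsIso ((c.ι d).app β) :=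
    fun β σ hσ => c.isIso_ι_app (hγ ▸ hσ.2)
  have hy : c.cellMap (𝟙 γ) hγ ≫ (c.toY d).app γ = c.y γ := by simp
  have hm : ∀ ⦃β : C⦄ (σ : γ ⟶ β) (hσ : Lowering r γ σ),
      c.cellMap (𝟙 γ) hγ ≫ (c.attach d).map σ = (c.m γ).map σ hσ ≫ (c.ι d).app β :=
    fun β σ hσ => by rw [cellMap_map, Category.id_comp, c.cellMap_eq_of_lowering σ hγ hσ]
  obtain ⟨w, w₁, w₂, w₃⟩ := H (a ≫ inv (c.cellMap (𝟙 γ) hγ)) y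
    ⟨fun {β} σ hσ => have := hi σ hσ; b.map σ hσ ≫ inv ((c.ι d).app β),
      fun {β β'} σ τ ρ hσ hρ hτ h => by
        have := hi σ hσ
        have := hi ρ hρ
        dsimp only
        rw [IsIso.eq_comp_inv, Category.assoc, Category.assoc, (c.ι d).naturality,
          IsIso.inv_hom_id_assoc, b.comp σ τ ρ hσ hρ hτ h]⟩
    (by rw [← hy, Category.assoc, IsIso.inv_hom_id_assoc, h₁])
    (fun β σ hσ => by
      have := hi σ hσ
      dsimp only
      rw [← Category.assoc, IsIso.eq_comp_inv, Category.assoc, Category.assoc, ← hm σ hσ,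
        IsIso.inv_hom_id_assoc]
      exact h₂ σ hσ)
    (fun β σ hσ => by
      have := hi σ hσ
      have e : (c.ι d).app β ≫ (c.toY d).app β = p.app β := congr_app c.ι_toY β
      rw [← e, Category.assoc, IsIso.inv_hom_id_assoc, h₃])
  refine ⟨w ≫ c.cellMap (𝟙 γ) hγ, ?_, ?_, fun β σ hσ => ?_⟩
  · rw [← Category.assoc, w₁, Category.assoc, IsIso.inv_hom_id, Category.comp_id]
  · rw [Category.assoc, hy, w₂]
  · have := hi σ hσ
    rw [Category.assoc, hm σ hσ, ← Category.assoc, w₃, Category.assoc,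
      IsIso.inv_hom_id, Category.comp_id]

end CellData

end Cells

/-! ### Factorizations -/

section Factorization

variable {C : Type} [Category.{0} C] {M : Type u} [Category.{v} M]
  {W₁ W₂ : MorphismProperty C} [W₁.IsMultiplicative] [W₂.IsMultiplicative]
  {r : ReedyStructure W₁ W₂ ℕ} {X Y Z : C ⥤ M}

lemma LatchingLift.id (X : C ⥤ M) (γ : C) {E B : M} (q : E ⟶ B) :
    LatchingLift r (𝟙 X) γ q := by
  intro x y e h₁ h₂ h₃
  refine ⟨x, by simp, by simpa using h₁, fun β δ hδ => by simpa using h₂ δ hδ⟩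

lemma LatchingLift.comp {i : X ⟶ Y} {j : Y ⟶ Z} {γ : C} {E B : M} {q : E ⟶ B}
    (hi : LatchingLift r i γ q) (hj : LatchingLift r j γ q) : LatchingLift r (i ≫ j) γ q := by
  intro x y e h₁ h₂ h₃
  obtain ⟨w, w₁, w₂, w₃⟩ := hi x (j.app γ ≫ y)
    ⟨fun δ hδ => j.app _ ≫ e.map δ hδ, fun δ τ ρ hδ hρ hτ h => by
      rw [← e.comp δ τ ρ hδ hρ hτ h, j.naturality_assoc]⟩
    (by simpa using h₁) (fun β δ hδ => by simpa using h₂ δ hδ)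
    (fun β δ hδ => by simp [h₃ δ hδ])
  obtain ⟨z, z₁, z₂, z₃⟩ := hj w y e w₂ w₃ h₃
  exact ⟨z, by simp [z₁, w₁], z₂, z₃⟩

lemma LatchingLift.of_isIso {j : X ⟶ Y} {γ : C} (hj : ∀ β, r.deg β ≤ r.deg γ → IsIso (j.app β))
    {E B : M} (q : E ⟶ B) : LatchingLift r j γ q := by
  intro x y e h₁ h₂ h₃
  have := hj γ le_rfl
  refine ⟨inv (j.app γ) ≫ x, by simp, by simp [h₁], fun β δ hδ => ?_⟩
  have := hj β hδ.2.le
  rw [← cancel_epi (j.app β), ← h₂ δ hδ, ← j.naturality_assoc, IsIso.hom_inv_id_assoc]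

lemma MatchingLift.of_isIso {j : X ⟶ Y} {p : Y ⟶ Z} {γ : C}
    (hj : ∀ β, r.deg β ≤ r.deg γ → IsIso (j.app β)) {A T : M} {l : A ⟶ T}
    (h : MatchingLift r (j ≫ p) γ l) : MatchingLift r p γ l := by
  intro a y b h₁ h₂ h₃
  have := hj γ le_rfl
  have hj' : ∀ ⦃β : C⦄ (σ : γ ⟶ β), Lowering r γ σ → IsIso (j.app β) := fun β σ hσ => hj β hσ.2.le
  obtain ⟨w, w₁, w₂, w₃⟩ := h (a ≫ inv (j.app γ)) y
    ⟨fun {β} σ hσ => have := hj' σ hσ; b.map σ hσ ≫ inv (j.app β),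
      fun {β β'} σ τ ρ hσ hρ hτ h => by
        have := hj' σ hσ
        have := hj' ρ hρ
        dsimp only
        rw [IsIso.eq_comp_inv, Category.assoc, Category.assoc, j.naturality,
          IsIso.inv_hom_id_assoc, b.comp σ τ ρ hσ hρ hτ h]⟩
    (by simp [h₁])
    (fun β σ hσ => by
      have := hj' σ hσ
      dsimp only
      rw [← Category.assoc, IsIso.eq_comp_inv, ← h₂ σ hσ]
      simp)
    (fun β σ hσ => by
      have := hj' σ hσ
      simp [h₃ σ hσ])
  refine ⟨w ≫ j.app γ, ?_, ?_, fun β σ hσ => ?_⟩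
  · rw [← Category.assoc, w₁, Category.assoc, IsIso.inv_hom_id, Category.comp_id]
  · rw [Category.assoc, ← w₂, NatTrans.comp_app]
  · have := hj' σ hσ
    rw [Category.assoc, ← j.naturality, ← Category.assoc, w₃, Category.assoc,
      IsIso.inv_hom_id, Category.comp_id]

variable [HasLimitsOfSize.{0, 0} M] [HasPullbacks M]

variable (r) in
/-- The factorizations of the relative matching maps given by intermediate objects. -/
@[simps]
def cellDataOfFactorization (p : X ⟶ Y) (N : C → M) (l : ∀ α, X.obj α ⟶ N α)
    (k : ∀ α, N α ⟶ pullback (matchingMap W₁ Y α) (matchingObjMap W₁ p α))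
    (fac : ∀ α, l α ≫ k α = relativeMatchingMap W₁ p α) : CellData r p where
  N := N
  l := l
  y α := k α ≫ pullback.fst _ _
  m α := matchingFamilyOfHom (k α ≫ pullback.snd _ _)
  l_y α := by rw [← Category.assoc, fac, relativeMatchingMap_fst]
  l_m {α β} σ hσ := by
    have := fac α =≫ (pullback.snd _ _ ≫ matchingπ X σ hσ)
    simpa using this
  m_app {α β} σ hσ := by
    have := k α ≫= pullback.condition (f := matchingMap W₁ Y α)
          (g := matchingObjMap W₁ p α) =≫ matchingπ Y σ hσ
    simpa using this.symm

variable [HasColimitsOfSize.{0, 0} M] [HasPushouts M] (L R : MorphismProperty M)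

-- One stage of the construction: factor each relative matching map as L followed by R and attach
-- the intermediate objects in degree d.
variable (r) in
lemma exists_attach [L.HasFactorization R]
    (hLR : ∀ ⦃A T E B : M⦄ (l : A ⟶ T) (q : E ⟶ B), L l → R q → HasLiftingProperty l q)
    (d : ℕ) (p : X ⟶ Y) :
    ∃ (Z : C ⥤ M) (j : X ⟶ Z) (p' : Z ⟶ Y), j ≫ p' = p ∧
      (∀ γ, r.deg γ < d → IsIso (j.app γ)) ∧
      (∀ ⦃E B : M⦄ (q : E ⟶ B), R q → ∀ γ, LatchingLift r j γ q) ∧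
      (∀ ⦃A T : M⦄ (l : A ⟶ T), L l → ∀ γ, r.deg γ = d → MatchingLift r p' γ l) := by
  choose N i k fac hi hk using fun α : C =>
    show ∃ (N : M) (i : X.obj α ⟶ N) (k : N ⟶ _), i ≫ k = relativeMatchingMap W₁ p α ∧
        L i ∧ R k from
      let F := MorphismProperty.factorizationData L R (relativeMatchingMap W₁ p α)
      ⟨F.Z, F.i, F.p, F.fac, F.hi, F.hp⟩
  let c := cellDataOfFactorization r p N i k fac
  refine ⟨c.attach d, c.ι d, c.toY d, c.ι_toY, fun γ hγ => c.isIso_ι_app hγ,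
    fun E B q hq γ => c.latchingLift_ι q (fun α => hLR _ _ (hi α) hq) γ,
    fun A T l hl γ hγ => c.matchingLift_toY hγ l fun (a : A ⟶ N γ) y b h₁ h₂ h₃ => ?_⟩
  have := hLR l (k γ) hl (hk γ)
  obtain ⟨t, t₁, t₂⟩ : ∃ t : T ⟶ pullback (matchingMap W₁ Y γ) (matchingObjMap W₁ p γ),
      t ≫ pullback.fst _ _ = y ∧ t ≫ pullback.snd _ _ = b.lift :=
    ⟨pullback.lift y b.lift (matchingObj_hom_ext r fun β σ hσ => by
      simpa using (h₃ σ hσ).symm), pullback.lift_fst _ _ _, pullback.lift_snd _ _ _⟩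
  have sq : CommSq a l (k γ) t := ⟨by
    apply pullback.hom_ext
    · rw [Category.assoc, Category.assoc, t₁]
      exact h₁
    · refine matchingObj_hom_ext r fun β σ hσ => ?_
      rw [Category.assoc l, t₂, Category.assoc l, b.lift_π, Category.assoc a, Category.assoc a]
      exact h₂ σ hσ⟩
  obtain ⟨⟨w, hw₁, hw₂⟩⟩ := (HasLiftingProperty.sq_hasLift sq).exists_lift
  refine ⟨w, hw₁, ?_, fun β σ hσ => ?_⟩
  · rw [← t₁, ← hw₂, Category.assoc]
    rfl
  · rw [← b.lift_π, ← t₂, ← hw₂, Category.assoc w, Category.assoc w]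
    rfl

variable (r) in
/-- A map of diagrams can be factored into a map whose relative latching maps are in the left
class followed by a map whose relative matching maps are in the right class. -/
lemma exists_reedy_factorization [L.HasFactorization R]
    (hLR : ∀ ⦃A T E B : M⦄ (l : A ⟶ T) (q : E ⟶ B), L l → R q → HasLiftingProperty l q)
    (f : X ⟶ Y) :
    ∃ (Z : C ⥤ M) (i : X ⟶ Z) (p : Z ⟶ Y), i ≫ p = f ∧
      (∀ ⦃E B : M⦄ (q : E ⟶ B), R q → ∀ γ, LatchingLift r i γ q) ∧
      (∀ ⦃A T : M⦄ (l : A ⟶ T), L l → ∀ γ, MatchingLift r p γ l) := by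
  have step (d : ℕ) (P : Over Y) : ∃ (Q : Over Y) (j : P ⟶ Q),
      (∀ γ, r.deg γ < d → IsIso (j.left.app γ)) ∧
      (∀ ⦃E B : M⦄ (q : E ⟶ B), R q → ∀ γ, LatchingLift r j.left γ q) ∧
      (∀ ⦃A T : M⦄ (l : A ⟶ T), L l → ∀ γ, r.deg γ = d → MatchingLift r Q.hom γ l) := by
    obtain ⟨Z, j, p', h, h₁, h₂, h₃⟩ := exists_attach r L R hLR d (Y := Y) P.hom
    exact ⟨Over.mk p', Over.homMk j h, h₁, h₂, h₃⟩
  choose next j hj hjL hjR using step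
  -- The n-th step treats degree n, so `seq (n + 1)` is correct in degree n and all later steps are
  -- isomorphisms there.
  let seq : ℕ → Over Y := fun n => Nat.rec (Over.mk f) next n
  let F : ℕ ⥤ Over Y := Functor.ofSequence (X := seq) fun n => j n (seq n)
  have hF (n : ℕ) : F.map (homOfLE n.le_succ) = j n (seq n) :=
    Functor.ofSequence_map_homOfLE_succ (X := seq) (fun n => j n (seq n)) n
  let G : ℕ ⥤ (C ⥤ M) := F ⋙ Over.forget Y
  have hG (n : ℕ) : G.map (homOfLE n.le_succ) = (j n (seq n)).left :=
    congrArg (fun φ => φ.left) (hF n)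
  have hG_comp {m n : ℕ} (h : m ≤ n) : G.map (homOfLE (h.trans n.le_succ)) =
      G.map (homOfLE h) ≫ G.map (homOfLE n.le_succ) := by
    rw [← G.map_comp]
    rfl
  have hG_iso (γ : C) (m n : ℕ) (h : m ≤ n) (hm : r.deg γ < m) :
      IsIso ((G.map (homOfLE h)).app γ) := by
    induction n, h using Nat.le_induction with
    | base =>
      rw [show homOfLE (le_refl m) = 𝟙 m from rfl, G.map_id]
      infer_instance
    | succ n h ih =>
      have : IsIso ((G.map (homOfLE n.le_succ)).app γ) := by
        rw [hG n]
        exact hj n (seq n) γ (hm.trans_le h)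
      rw [hG_comp h, NatTrans.comp_app]
      infer_instance
  -- Evaluation at γ preserves the colimit, and the evaluated sequence is constant from m on.
  have hι (γ : C) (m : ℕ) (hm : r.deg γ < m) : IsIso ((colimit.ι G m).app γ) := by
    have : (G ⋙ (evaluation C M).obj γ).IsEventuallyConstantFrom m :=
      fun n φ => hG_iso γ m n (leOfHom φ) hm
    exact this.isIso_ι_of_isColimit
      (isColimitOfPreserves ((evaluation C M).obj γ) (colimit.isColimit G))
  let s : Cocone G :=
    { pt := Y
      ι :=
        { app := fun n => (F.obj n).hom
          naturality := fun m n φ => by simp [G] } }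
  have fac (n : ℕ) : colimit.ι G n ≫ colimit.desc G s = (seq n).hom := colimit.ι_desc s n
  refine ⟨colimit G, colimit.ι G 0, colimit.desc G s, fac 0, ?_, ?_⟩
  · intro E B q hq γ
    have key (n : ℕ) : LatchingLift r (G.map (homOfLE n.zero_le)) γ q := by
      induction n with
      | zero =>
        rw [show homOfLE (Nat.zero_le 0) = 𝟙 0 from rfl, G.map_id]
        exact LatchingLift.id _ γ q
      | succ n ih =>
        rw [hG_comp n.zero_le, hG n]
        exact ih.comp (hjL n (seq n) q hq γ)
    rw [← colimit.w G (homOfLE (r.deg γ + 1).zero_le)]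
    exact (key _).comp (.of_isIso (fun β hβ => hι β _ (Nat.lt_succ_of_le hβ)) q)
  · intro A T l hl γ
    refine .of_isIso (j := colimit.ι G (r.deg γ + 1))
      (fun β hβ => hι β _ (Nat.lt_succ_of_le hβ)) ?_
    rw [fac]
    exact hjR _ _ l hl γ rfl

end Factorization

/-! ### The Reedy model structure -/

section ModelStructure

variable {C : Type} [Category.{0} C] {M : Type u} [Category.{v} M]
  {W₁ W₂ : MorphismProperty C} [W₁.IsMultiplicative] [W₂.IsMultiplicative]
  (r : ReedyStructure W₁ W₂ ℕ)

/-! ### Closure of the lifting conditions under retracts -/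

section

variable {X Y X' Y' : C ⥤ M} {f : X ⟶ Y} {g : X' ⟶ Y'}

lemma exists_of_retractArrow (h : RetractArrow f g) :
    ∃ (i₁ : X ⟶ X') (i₂ : Y ⟶ Y') (r₁ : X' ⟶ X) (r₂ : Y' ⟶ Y), f ≫ i₂ = i₁ ≫ g ∧
      g ≫ r₂ = r₁ ≫ f ∧ i₁ ≫ r₁ = 𝟙 _ ∧ i₂ ≫ r₂ = 𝟙 _ :=
  ⟨h.i.left, h.i.right, h.r.left, h.r.right, h.i_w.symm, h.r_w.symm, h.retract_left,
    h.retract_right⟩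

variable {r} in
lemma LatchingLift.of_retract (h : RetractArrow f g) {α : C} {E B : M} {q : E ⟶ B}
    (hg : LatchingLift r g α q) : LatchingLift r f α q := by
  obtain ⟨i₁, i₂, r₁, r₂, hi, hr, h₁, h₂⟩ := exists_of_retractArrow h
  replace h₁ := congr_app h₁
  replace h₂ := congr_app h₂
  replace hi := congr_app hi
  replace hr := congr_app hr
  simp only [NatTrans.comp_app, NatTrans.id_app] at h₁ h₂ hi hr
  intro x y e e₁ e₂ e₃
  obtain ⟨w, w₁, w₂, w₃⟩ := hg (r₁.app α ≫ x) (r₂.app α ≫ y)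
    ⟨fun δ hδ => r₂.app _ ≫ e.map δ hδ, fun δ τ ρ hδ hρ hτ t => by
      rw [← e.comp δ τ ρ hδ hρ hτ t, r₂.naturality_assoc]⟩
    (by rw [Category.assoc, e₁, ← Category.assoc, ← hr, Category.assoc])
    (fun β δ hδ => by
      dsimp only
      rw [r₁.naturality_assoc, e₂ δ hδ, ← Category.assoc, ← hr, Category.assoc])
    (fun β δ hδ => by
      dsimp only
      rw [r₂.naturality_assoc, Category.assoc, e₃ δ hδ])
  refine ⟨i₂.app α ≫ w, ?_, ?_, fun β δ hδ => ?_⟩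
  · rw [← Category.assoc, hi, Category.assoc, w₁, ← Category.assoc, h₁, Category.id_comp]
  · rw [Category.assoc, w₂, ← Category.assoc, h₂, Category.id_comp]
  · rw [i₂.naturality_assoc, w₃ δ hδ, ← Category.assoc, h₂, Category.id_comp]

variable {r} in
lemma MatchingLift.of_retract (h : RetractArrow f g) {α : C} {A T : M} {l : A ⟶ T}
    (hg : MatchingLift r g α l) : MatchingLift r f α l := by
  obtain ⟨i₁, i₂, r₁, r₂, hi, hr, h₁, h₂⟩ := exists_of_retractArrow h
  replace h₁ := congr_app h₁
  replace h₂ := congr_app h₂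
  replace hi := congr_app hi
  replace hr := congr_app hr
  simp only [NatTrans.comp_app, NatTrans.id_app] at h₁ h₂ hi hr
  intro a y b b₁ b₂ b₃
  obtain ⟨w, w₁, w₂, w₃⟩ := hg (a ≫ i₁.app α) (y ≫ i₂.app α)
    ⟨fun σ hσ => b.map σ hσ ≫ i₁.app _, fun σ τ ρ hσ hρ hτ t => by
      rw [← b.comp σ τ ρ hσ hρ hτ t, Category.assoc, Category.assoc, i₁.naturality]⟩
    (by rw [Category.assoc, ← hi, ← Category.assoc, b₁, Category.assoc])
    (fun β σ hσ => by
      dsimp only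
      rw [Category.assoc, ← i₁.naturality, ← Category.assoc, b₂ σ hσ, Category.assoc])
    (fun β σ hσ => by
      dsimp only
      rw [Category.assoc, ← hi, ← Category.assoc, b₃ σ hσ, Category.assoc, Category.assoc,
        i₂.naturality])
  refine ⟨w ≫ r₁.app α, ?_, ?_, fun β σ hσ => ?_⟩
  · rw [← Category.assoc, w₁, Category.assoc, h₁, Category.comp_id]
  · rw [Category.assoc, ← hr, ← Category.assoc, w₂, Category.assoc, h₂, Category.comp_id]
  · rw [Category.assoc, ← r₁.naturality, ← Category.assoc, w₃ σ hσ, Category.assoc, h₁,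
      Category.comp_id]

end

/-- The maps of diagrams all of whose relative latching maps are in `L`. -/
def relativeLatching [HasColimitsOfSize.{0, 0} M] [HasPushouts M]
    (W₂ : MorphismProperty C) [W₂.IsMultiplicative]
    (L : MorphismProperty M) : MorphismProperty (C ⥤ M) :=
  fun _ _ f => ∀ α : C, L (relativeLatchingMap W₂ f α)

/-- The maps of diagrams all of whose relative matching maps are in `R`. -/
def relativeMatching [HasLimitsOfSize.{0, 0} M] [HasPullbacks M]
    (W₁ : MorphismProperty C) [W₁.IsMultiplicative]
    (R : MorphismProperty M) : MorphismProperty (C ⥤ M) :=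
  fun _ _ f => ∀ α : C, R (relativeMatchingMap W₁ f α)

variable (L R : MorphismProperty M)
  [MorphismProperty.IsWeakFactorizationSystem L R]

lemma relativeLatching_iff [HasColimitsOfSize.{0, 0} M] [HasPushouts M]
    {X Y : C ⥤ M} (f : X ⟶ Y) :
    relativeLatching W₂ L f ↔ ∀ ⦃E B : M⦄ (q : E ⟶ B), R q → ∀ α, LatchingLift r f α q := by
  simp only [relativeLatching, ← hasLiftingProperty_relativeLatchingMap_iff,
    ← MorphismProperty.llp_eq_of_wfs L R, MorphismProperty.llp]
  exact ⟨fun h _ _ q hq α => h α q hq, fun h α _ _ q hq => h q hq α⟩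

lemma relativeMatching_iff [HasLimitsOfSize.{0, 0} M] [HasPullbacks M]
    {X Y : C ⥤ M} (f : X ⟶ Y) :
    relativeMatching W₁ R f ↔ ∀ ⦃A T : M⦄ (l : A ⟶ T), L l → ∀ α, MatchingLift r f α l := by
  simp only [relativeMatching, ← hasLiftingProperty_relativeMatchingMap_iff,
    ← MorphismProperty.rlp_eq_of_wfs L R, MorphismProperty.rlp]
  exact ⟨fun h _ _ q hq α => h α q hq, fun h α _ _ q hq => h q hq α⟩

include r in
/-- A weak factorization system induces one on categories of Reedy diagrams. -/
lemma isWeakFactorizationSystem_relative [HasLimitsOfSize.{0, 0} M] [HasColimitsOfSize.{0, 0} M]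
    [HasPullbacks M] [HasPushouts M] :
    MorphismProperty.IsWeakFactorizationSystem
      (relativeLatching W₂ L) (relativeMatching (M := M) W₁ R) := by
  have : (relativeLatching W₂ L).HasFactorization (relativeMatching (M := M) W₁ R) := ⟨fun f => by
    obtain ⟨Z, i, p, fac, hi, hp⟩ := exists_reedy_factorization r L R
      (fun _ _ _ _ l q hl hq => MorphismProperty.hasLiftingProperty_of_wfs l q hl hq) f
    exact ⟨⟨Z, i, p, fac, (relativeLatching_iff r L R i).2 hi, (relativeMatching_iff r L R p).2 hp⟩⟩⟩
  have : (relativeLatching (M := M) W₂ L).IsStableUnderRetracts := ⟨fun h hg => by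
    rw [relativeLatching_iff r L R] at hg ⊢
    exact fun _ _ q hq α => (hg q hq α).of_retract h⟩
  have : (relativeMatching (M := M) W₁ R).IsStableUnderRetracts := ⟨fun h hg => by
    rw [relativeMatching_iff r L R] at hg ⊢
    exact fun _ _ q hq α => (hg q hq α).of_retract h⟩
  exact .mk' _ _ fun i p hi hp => hasLiftingProperty_of_relative r i p fun α =>
    MorphismProperty.hasLiftingProperty_of_wfs _ _ (hi α) (hp α)

end ModelStructure

/-! ### Trivial Reedy fibrations and cofibrations, and the model structure -/

section ModelStructure

variable {C : Type} [Category.{0} C] {M : Type u} [Category.{v} M]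
  {W₁ W₂ : MorphismProperty C} [W₁.IsMultiplicative] [W₂.IsMultiplicative]
  (r : ReedyStructure W₁ W₂ ℕ) [ModelCategory M] [HasLimitsOfSize.{0, 0} M]

-- From left to right, the components inherit the lifting property of the relative matching maps.
-- Conversely, by induction on the degree the map of matching objects is a trivial fibration, hence
-- so is its base change over `Y.obj α`, and two-out-of-three applies to the relative matching map.
include r in
lemma relativeMatching_trivialFibrations :
    relativeMatching W₁ (trivialFibrations M) =
      reedyFibrations (M := M) W₁ ⊓ reedyWeakEquivalences := by
  ext X Y p
  constructor
  · intro h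
    refine ⟨fun α => (h α).1, fun α => ?_⟩
    have : trivialFibrations M (p.app α) := by
      rw [← cofibrations_rlp]
      intro _ _ l hl
      exact hasLiftingProperty_app_of_matchingLift p l
        ((relativeMatching_iff r (cofibrations M) _ p).1 h l hl) α
    exact this.2
  · rintro ⟨hp, hw⟩
    have key : ∀ (d : ℕ) (α : C), r.deg α < d →
        trivialFibrations M (relativeMatchingMap W₁ p α) := by
      intro d
      induction d with
      | zero => exact fun α hα => (Nat.not_lt_zero _ hα).elim
      | succ d ih =>
        intro α hα
        have h : trivialFibrations M (matchingObjMap W₁ p α) := by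
          rw [← cofibrations_rlp]
          intro _ _ l hl
          refine hasLiftingProperty_matchingObjMap (r := r) p l α fun β hβ => ?_
          rw [← hasLiftingProperty_relativeMatchingMap_iff r]
          exact MorphismProperty.hasLiftingProperty_of_wfs _ _ hl (ih β (by lia))
        rw [mem_trivialFibrations_iff] at h
        obtain ⟨_, _⟩ := h
        have : WeakEquivalence (p.app α) := ⟨hw α⟩
        refine ⟨hp α, ?_⟩
        rw [← weakEquivalence_iff]
        exact weakEquivalence_of_postcomp_of_fac (relativeMatchingMap_fst p α)
    exact fun α => key _ α (Nat.lt_succ_self _)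

variable [HasColimitsOfSize.{0, 0} M]

-- No dual induction is needed. A Reedy cofibration and weak equivalence f factors as a map with
-- trivially cofibrant relative latching maps followed by a Reedy fibration. The latter is trivial
-- by two-out-of-three, so f lifts against it and is a retract of the former.
include r in
lemma relativeLatching_trivialCofibrations :
    relativeLatching W₂ (trivialCofibrations M) =
      reedyCofibrations (M := M) W₂ ⊓ reedyWeakEquivalences := by
  have h_le : relativeLatching W₂ (trivialCofibrations M) ≤
      reedyWeakEquivalences (C := C) (M := M) := by
    intro X Y i h α
    have : trivialCofibrations M (i.app α) := by
      rw [← fibrations_llp]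
      intro _ _ q hq
      exact hasLiftingProperty_app_of_latchingLift i q
        ((relativeLatching_iff r _ (fibrations M) i).1 h q hq) α
    exact this.2
  have := isWeakFactorizationSystem_relative r (trivialCofibrations M) (fibrations M)
  have := isWeakFactorizationSystem_relative r (cofibrations M) (trivialFibrations M)
  ext X Y f
  refine ⟨fun h => ⟨fun α => (h α).1, h_le _ h⟩, fun ⟨hf, hw⟩ => ?_⟩
  let F := MorphismProperty.factorizationData (relativeLatching W₂ (trivialCofibrations M))
    (relativeMatching W₁ (fibrations M)) f
  have hp : relativeMatching W₁ (trivialFibrations M) F.p := by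
    rw [relativeMatching_trivialFibrations r]
    refine ⟨F.hp, fun α => ?_⟩
    have : WeakEquivalence (F.i.app α) := ⟨h_le _ F.hi α⟩
    have : WeakEquivalence (f.app α) := ⟨hw α⟩
    rw [← weakEquivalence_iff]
    exact weakEquivalence_of_precomp_of_fac (congr_app F.fac α)
  have : HasLiftingProperty f F.p :=
    MorphismProperty.hasLiftingProperty_of_wfs (W₁ := relativeLatching W₂ (cofibrations M)) _ _
      hf hp
  have : (relativeLatching (M := M) W₂ (trivialCofibrations M)).IsStableUnderRetracts := by
    rw [← MorphismProperty.llp_eq_of_wfs (relativeLatching W₂ (trivialCofibrations M))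
      (relativeMatching W₁ (fibrations M))]
    infer_instance
  exact MorphismProperty.of_retract (RetractArrow.ofLeftLiftingProperty F.fac) F.hi

/-- The Reedy model category structure. -/
abbrev reedyModelCategory : ModelCategory (C ⥤ M) :=
  letI : CategoryWithFibrations (C ⥤ M) := ⟨reedyFibrations W₁⟩
  letI : CategoryWithCofibrations (C ⥤ M) := ⟨reedyCofibrations W₂⟩
  letI : CategoryWithWeakEquivalences (C ⥤ M) := ⟨reedyWeakEquivalences⟩
  haveI : (weakEquivalences (C ⥤ M)).HasTwoOutOfThreeProperty :=
    { comp_mem := fun f g hf hg α => (weakEquivalences M).comp_mem _ _ (hf α) (hg α)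
      of_postcomp := fun f g hg hfg α => (weakEquivalences M).of_postcomp _ _ (hg α) (hfg α)
      of_precomp := fun f g hf hfg α => (weakEquivalences M).of_precomp _ _ (hf α) (hfg α) }
  haveI : MorphismProperty.IsWeakFactorizationSystem (cofibrations (C ⥤ M))
      (trivialFibrations (C ⥤ M)) := by
    have := isWeakFactorizationSystem_relative r (cofibrations M) (trivialFibrations M)
    rwa [relativeMatching_trivialFibrations r] at this
  haveI : MorphismProperty.IsWeakFactorizationSystem (trivialCofibrations (C ⥤ M))
      (fibrations (C ⥤ M)) := by
    have := isWeakFactorizationSystem_relative r (trivialCofibrations M) (fibrations M)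
    rwa [relativeLatching_trivialCofibrations r] at this
  .mk' _

lemma isReedyModelStructure_reedyModelCategory :
    IsReedyModelStructure W₁ W₂ (reedyModelCategory (M := M) r) :=
  ⟨rfl, rfl, rfl⟩

end ModelStructure

/-! ### The Reedy categories `Δ` and `Δⁿ` -/

section Reedy

lemma epi_of_deltaInverse {k m : SimplexCategory} {f : k ⟶ m} (hf : deltaInverse f) : Epi f :=
  SimplexCategory.epi_iff_surjective.2 hf

lemma mono_of_deltaDirect {k m : SimplexCategory} {f : k ⟶ m} (hf : deltaDirect f) : Mono f :=
  SimplexCategory.mono_iff_injective.2 hf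

lemma deltaInverse_of_epi {k m : SimplexCategory} (f : k ⟶ m) [hf : Epi f] : deltaInverse f :=
  SimplexCategory.epi_iff_surjective.1 hf

lemma deltaDirect_of_mono {k m : SimplexCategory} (f : k ⟶ m) [hf : Mono f] : deltaDirect f :=
  SimplexCategory.mono_iff_injective.1 hf

lemma len_lt_or_identities_of_deltaInverse {k m : SimplexCategory} {f : k ⟶ m}
    (hf : deltaInverse f) : m.len < k.len ∨ MorphismProperty.identities _ f := by
  have := epi_of_deltaInverse hf
  refine (SimplexCategory.len_le_of_epi f).lt_or_eq.imp_right fun h => ?_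
  obtain rfl : k = m := SimplexCategory.ext (by lia)
  rw [SimplexCategory.eq_id_of_epi f]
  exact ⟨_⟩

lemma len_lt_or_identities_of_deltaDirect {k m : SimplexCategory} {f : k ⟶ m}
    (hf : deltaDirect f) : k.len < m.len ∨ MorphismProperty.identities _ f := by
  have := mono_of_deltaDirect hf
  refine (SimplexCategory.len_le_of_mono f).lt_or_eq.imp_right fun h => ?_
  obtain rfl : k = m := SimplexCategory.ext (by lia)
  rw [SimplexCategory.eq_id_of_mono f]
  exact ⟨_⟩

/-- The Reedy structure of `Δ`. -/
def deltaReedy : ReedyStructure deltaInverse deltaDirect ℕ where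
  deg := SimplexCategory.len
  lt₁ _ hf hf' := (len_lt_or_identities_of_deltaInverse hf).resolve_right hf'
  lt₂ _ hf hf' := (len_lt_or_identities_of_deltaDirect hf).resolve_right hf'
  nonempty_unique f := ⟨⟨⟨image f, factorThruImage f, image.ι f, image.fac f,
      deltaInverse_of_epi _, deltaDirect_of_mono _⟩⟩, by
    rintro ⟨Z, i, p, fac, hi, hp⟩
    have := epi_of_deltaInverse hi
    have := mono_of_deltaDirect hp
    obtain rfl := SimplexCategory.image_eq fac
    obtain rfl := SimplexCategory.image_ι_eq fac
    obtain rfl := SimplexCategory.factorThruImage_eq fac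
    rfl⟩

lemma identities_pi {n : ℕ} {α β : MultiDelta n} {f : α ⟶ β}
    (hf : ∀ i, MorphismProperty.identities _ (f i)) : MorphismProperty.identities _ f := by
  have h : α = β := by
    funext i
    have h : ∀ {a b : SimplexCategory} (g : a ⟶ b), MorphismProperty.identities _ g → a = b := by
      rintro _ _ _ ⟨_⟩
      rfl
    exact h _ (hf i)
  subst h
  have : f = 𝟙 α := by
    funext i
    have h : ∀ {a b : SimplexCategory} (g : a ⟶ b) (hab : a = b),
        MorphismProperty.identities _ g → g = eqToHom hab := by
      rintro _ _ _ _ ⟨_⟩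
      rfl
    exact h _ rfl (hf i)
  rw [this]
  exact ⟨_⟩

/-- A factorization in `Δⁿ` is a family of factorizations in `Δ`. -/
def multiDeltaFactorizationEquiv {n : ℕ} {α β : MultiDelta n} (f : α ⟶ β) :
    (multiDeltaInverse n).MapFactorizationData (multiDeltaDirect n) f ≃
      ∀ i, deltaInverse.MapFactorizationData deltaDirect (f i) where
  toFun d i := ⟨d.Z i, d.i i, d.p i, congrFun d.fac i, d.hi i, d.hp i⟩
  invFun d := ⟨fun i => (d i).Z, fun i => (d i).i, fun i => (d i).p, funext fun i => (d i).fac,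
    fun i => (d i).hi, fun i => (d i).hp⟩
  left_inv _ := rfl
  right_inv _ := rfl

/-- The product Reedy structure of `Δⁿ`. -/
def multiDeltaReedy (n : ℕ) : ReedyStructure (multiDeltaInverse n) (multiDeltaDirect n) ℕ where
  deg α := ∑ i, (α i).len
  lt₁ {α β} f hf hf' := by
    have h := fun i => len_lt_or_identities_of_deltaInverse (hf i)
    -- No component raises the degree, so if the sum does not drop, no component drops and each is
    -- an identity.
    by_contra! hle
    refine hf' (identities_pi fun i => (h i).resolve_left fun hi => hle.not_gt ?_)
    have (i : Fin n) := epi_of_deltaInverse (hf i)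
    exact Finset.sum_lt_sum (fun i _ => SimplexCategory.len_le_of_epi (f i))
      ⟨i, Finset.mem_univ _, hi⟩
  lt₂ {α β} f hf hf' := by
    have h := fun i => len_lt_or_identities_of_deltaDirect (hf i)
    by_contra! hle
    refine hf' (identities_pi fun i => (h i).resolve_left fun hi => hle.not_gt ?_)
    have (i : Fin n) := mono_of_deltaDirect (hf i)
    exact Finset.sum_lt_sum (fun i _ => SimplexCategory.len_le_of_mono (f i))
      ⟨i, Finset.mem_univ _, hi⟩
  nonempty_unique f := by
    have (i : Fin n) := (deltaReedy.nonempty_unique (f i)).some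
    exact ⟨(multiDeltaFactorizationEquiv f).unique⟩

end Reedy

/-! ### The joint image of a family of maps -/

section JointImage

/-- A section of an epimorphism of `Δ`. -/
def deltaSection {k m : SimplexCategory} (s : k ⟶ m) [Epi s] : m ⟶ k :=
  (isSplitEpi_of_epi s).exists_splitEpi.some.section_

lemma deltaSection_comp {k m : SimplexCategory} (s : k ⟶ m) [Epi s] : deltaSection s ≫ s = 𝟙 m :=
  (isSplitEpi_of_epi s).exists_splitEpi.some.id

/-- A map constant on the fibres of s factors through s, and a section of s provides the factor. -/
lemma comp_deltaSection_comp {k m l : SimplexCategory} (s : k ⟶ m) [Epi s] (f : k ⟶ l)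
    (h : ∀ x y, s.toOrderHom x = s.toOrderHom y → f.toOrderHom x = f.toOrderHom y) :
    s ≫ deltaSection s ≫ f = f := by
  ext x : 3
  exact h _ _ (congrArg (fun g => g.toOrderHom (s.toOrderHom x)) (deltaSection_comp s))

variable {n : ℕ} {k : SimplexCategory} {β γ : MultiDelta n}

/-- The sum of the components of a map from a diagonal object of `Δⁿ`. -/
def sumHom (σ : ∀ i, k ⟶ β i) : k ⟶ SimplexCategory.mk (∑ i, (β i).len) :=
  SimplexCategory.mkHom
    { toFun x := ⟨∑ i, ((σ i).toOrderHom x : ℕ), Nat.lt_succ_of_le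
        (Finset.sum_le_sum fun i _ => Nat.le_of_lt_succ ((σ i).toOrderHom x).2)⟩
      monotone' _ _ h := Fin.mk_le_mk.2
        (Finset.sum_le_sum fun i _ => (σ i).toOrderHom.monotone h) }

/-- For x ≤ y every component is monotone, so equality of the sums forces equality of all terms. The
single map `sumHom σ` thus has the common fibres of the components, and its image is their joint
image. -/
lemma sumHom_eq_iff (σ : ∀ i, k ⟶ β i) (x y : Fin (k.len + 1)) :
    (sumHom σ).toOrderHom x = (sumHom σ).toOrderHom y ↔
      ∀ i, (σ i).toOrderHom x = (σ i).toOrderHom y := by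
  have h : (sumHom σ).toOrderHom x = (sumHom σ).toOrderHom y ↔
      ∑ i, ((σ i).toOrderHom x : ℕ) = ∑ i, ((σ i).toOrderHom y : ℕ) :=
    Fin.ext_iff (a := (sumHom σ).toOrderHom x)
  simp only [h, Fin.ext_iff]
  wlog hxy : x ≤ y generalizing x y
  · exact eq_comm.trans ((this y x Fin.ext_iff (le_of_not_ge hxy)).trans
      (forall_congr' fun _ => eq_comm))
  rw [Finset.sum_eq_sum_iff_of_le fun i _ => (σ i).toOrderHom.monotone hxy]
  simp

/-- The object of `Δ` through which the components of a map `D[k] ⟶ β` jointly factor. -/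
def jointImage (σ : (diagonalEmbedding n).obj k ⟶ β) : SimplexCategory := image (sumHom σ)

/-- The surjection through which the components of a map `D[k] ⟶ β` jointly factor. -/
def jointEpi (σ : (diagonalEmbedding n).obj k ⟶ β) : k ⟶ jointImage σ :=
  factorThruImage (sumHom σ)

instance (σ : (diagonalEmbedding n).obj k ⟶ β) : Epi (jointEpi σ) :=
  inferInstanceAs (Epi (factorThruImage (sumHom σ)))

lemma jointEpi_eq_iff (σ : (diagonalEmbedding n).obj k ⟶ β) (x y : Fin (k.len + 1)) :
    (jointEpi σ).toOrderHom x = (jointEpi σ).toOrderHom y ↔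
      ∀ i, (σ i).toOrderHom x = (σ i).toOrderHom y := by
  have h (z) : (image.ι (sumHom σ)).toOrderHom ((jointEpi σ).toOrderHom z) =
      (sumHom σ).toOrderHom z :=
    congrArg (fun g => g.toOrderHom z) (image.fac (sumHom σ))
  have hinj : Function.Injective (image.ι (sumHom σ)).toOrderHom :=
    SimplexCategory.mono_iff_injective.1 inferInstance
  refine Iff.trans ?_ (sumHom_eq_iff σ x y)
  rw [← h x, ← h y]
  exact hinj.eq_iff.symm

/-- The map from the joint image. -/
def jointι (σ : (diagonalEmbedding n).obj k ⟶ β) :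
    (diagonalEmbedding n).obj (jointImage σ) ⟶ β :=
  fun i => (deltaSection (jointEpi σ) ≫ (σ i : k ⟶ β i) : jointImage σ ⟶ β i)

lemma jointEpi_jointι (σ : (diagonalEmbedding n).obj k ⟶ β) :
    (diagonalEmbedding n).map (jointEpi σ) ≫ jointι σ = σ := by
  funext i
  exact comp_deltaSection_comp (k := k) (m := jointImage σ) (l := β i) (jointEpi σ) (σ i)
    fun x y h => (jointEpi_eq_iff σ x y).1 h i

/-- The comparison of a surjection with the joint image of a map which factors through it. -/
lemma exists_comp_eq_jointEpi {m : SimplexCategory} (s : k ⟶ m) [Epi s]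
    (τ : (diagonalEmbedding n).obj m ⟶ β) :
    ∃ t : m ⟶ jointImage ((diagonalEmbedding n).map s ≫ τ),
      s ≫ t = jointEpi ((diagonalEmbedding n).map s ≫ τ) ∧
      (diagonalEmbedding n).map t ≫ jointι _ = τ := by
  have h := comp_deltaSection_comp s (jointEpi ((diagonalEmbedding n).map s ≫ τ)) fun x y h =>
    (jointEpi_eq_iff _ x y).2 fun i => congrArg (τ i).toOrderHom h
  refine ⟨_, h, funext fun i => (cancel_epi s).1 ?_⟩
  refine (Category.assoc _ _ _).symm.trans
    (Eq.trans ?_ (congrFun (jointEpi_jointι ((diagonalEmbedding n).map s ≫ τ)) i))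
  exact congrArg (· ≫ jointι _ i) h

end JointImage

/-! ### The diagonal of a map with the lifting property at all matching objects -/

section Diagonal

variable {n : ℕ} {M : Type u} [Category.{v} M]

/-- The family b lives on the proper surjections out of [k]. It is transported to the maps σ out of
D[k] with proper joint image by setting its value at σ to that of b at `jointEpi σ` followed by
`X.map (jointι σ)`. -/
lemma MatchingLift.diagonal {X Y : MultiDelta n ⥤ M} (p : X ⟶ Y) {A T : M} (l : A ⟶ T)
    (hp : ∀ β, MatchingLift (multiDeltaReedy n) p β l) (k : SimplexCategory) :
    MatchingLift deltaReedy ((diagonal n M).map p) k l := by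
  intro a y b h₁ h₂ h₃
  -- Joint images are functorial: composing with τ can only enlarge the common fibres. This yields
  -- both the closure of the class and the compatibility of the transported family.
  have key {β γ : MultiDelta n} (σ : (diagonalEmbedding n).obj k ⟶ β) (τ : β ⟶ γ)
      (ρ : (diagonalEmbedding n).obj k ⟶ γ) (h : σ ≫ τ = ρ) :
      ∃ t : jointImage σ ⟶ jointImage ρ, jointEpi σ ≫ t = jointEpi ρ ∧
        (diagonalEmbedding n).map t ≫ jointι ρ = jointι σ ≫ τ := by
    have h' : (diagonalEmbedding n).map (jointEpi σ) ≫ jointι σ ≫ τ = ρ := by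
      rw [← Category.assoc, jointEpi_jointι, h]
    obtain rfl := h'
    exact exists_comp_eq_jointEpi _ _
  have hcomp {m m' : SimplexCategory} {s : k ⟶ m} {t : m ⟶ m'} {s' : k ⟶ m'} [Epi s']
      (h : s ≫ t = s') : deltaInverse t := by
    have : Epi (s ≫ t) := by rwa [h]
    have := epi_of_epi s t
    exact deltaInverse_of_epi t
  obtain ⟨w, w₁, w₂, w₃⟩ := exists_lift_of_matchingLift p l hp
    (S := fun β σ => multiDeltaInverse n σ ∧ Lowering deltaReedy k (jointEpi σ))
    (α := (diagonalEmbedding n).obj k) (fun _ _ h => h.1)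
    (fun β γ σ τ hσ hτ => ⟨MorphismProperty.comp_mem _ _ _ hσ.1 hτ, by
      obtain ⟨t, ht, -⟩ := key σ τ _ rfl
      rw [← ht]
      exact hσ.2.comp (hcomp ht)⟩)
    a y
    ⟨fun {β} σ hσ => b.map (jointEpi σ) hσ.2 ≫ X.map (jointι σ), fun σ τ ρ hσ hρ hτ h => by
      obtain ⟨t, ht, ht'⟩ := key σ τ _ h
      rw [← b.comp _ t _ hσ.2 hρ.2 (hcomp ht) ht, Category.assoc, Category.assoc,
        ← X.map_comp, ← ht', X.map_comp]
      rfl⟩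
    h₁
    (fun β σ hσ => by
      have := h₂ _ hσ.2
      dsimp only
      rw [← Category.assoc, ← this, Category.assoc]
      conv_lhs => rw [← jointEpi_jointι σ, X.map_comp]
      rfl)
    (fun β σ hσ => by
      have := h₃ _ hσ.2
      dsimp only
      rw [Category.assoc, p.naturality, ← Category.assoc]
      conv_rhs => rw [← jointEpi_jointι σ, Y.map_comp, ← Category.assoc]
      exact congrArg (· ≫ Y.map (jointι σ)) this)
  refine ⟨w, w₁, w₂, fun m s hs => ?_⟩
  have := epi_of_deltaInverse hs.1
  -- At σ = D(s) the transported value must be `b.map s` again; t compares s with the joint image of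
  -- D(s), and D(t) followed by `jointι` is the identity.
  obtain ⟨t, ht, ht'⟩ : ∃ t : m ⟶ jointImage ((diagonalEmbedding n).map s),
      s ≫ t = jointEpi ((diagonalEmbedding n).map s) ∧
        (diagonalEmbedding n).map t ≫ jointι _ = 𝟙 _ := by
    have := exists_comp_eq_jointEpi (n := n) s (𝟙 _)
    rwa [Category.comp_id] at this
  have hS : Lowering deltaReedy k (jointEpi ((diagonalEmbedding n).map s)) := by
    rw [← ht]
    exact hs.comp (hcomp ht)
  refine (w₃ ((diagonalEmbedding n).map s) ⟨fun _ => hs.1, hS⟩).trans ?_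
  dsimp only
  rw [← b.comp s t _ hs hS (hcomp ht) ht, Category.assoc]
  refine (congrArg (b.map s hs ≫ ·) ?_).trans (Category.comp_id _)
  exact (X.map_comp _ _).symm.trans ((congrArg X.map ht').trans (X.map_id _))

variable [HasLimitsOfSize.{0, 0} M] [HasPullbacks M]

lemma relativeMatching_diagonal (L R : MorphismProperty M)
    [MorphismProperty.IsWeakFactorizationSystem L R] {X Y : MultiDelta n ⥤ M} (p : X ⟶ Y)
    (hp : relativeMatching (multiDeltaInverse n) R p) :
    relativeMatching deltaInverse R ((diagonal n M).map p) :=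
  (relativeMatching_iff deltaReedy L R _).2 fun _ _ l hl =>
    MatchingLift.diagonal p l ((relativeMatching_iff (multiDeltaReedy n) L R p).1 hp l hl)

end Diagonal

/-! ### Quillen pairs recognised on the right adjoint -/

section Quillen

variable {C : Type u} [Category.{v} C] [ModelCategory C]
  {D : Type u'} [Category.{v'} D] [ModelCategory D]

/-- An adjunction whose right adjoint preserves fibrations and trivial fibrations is a Quillen
pair. -/
lemma IsQuillenPair.of_rightAdjoint {F : D ⥤ C} {U : C ⥤ D} (adj : F ⊣ U)
    (h₁ : ∀ {X Y : C} (f : X ⟶ Y), fibrations C f → fibrations D (U.map f))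
    (h₂ : ∀ {X Y : C} (f : X ⟶ Y), trivialFibrations C f → trivialFibrations D (U.map f)) :
    IsQuillenPair adj where
  cofibration_map f hf := by
    rw [← trivialFibrations_llp]
    intro _ _ q hq
    rw [adj.hasLiftingProperty_iff]
    exact MorphismProperty.hasLiftingProperty_of_wfs _ _ hf (h₂ q hq)
  trivialCofibration_map f hf := by
    rw [← fibrations_llp]
    intro _ _ q hq
    rw [adj.hasLiftingProperty_iff]
    exact MorphismProperty.hasLiftingProperty_of_wfs _ _ hf (h₁ q hq)
  fibration_map := h₁
  trivialFibration_map := h₂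

end Quillen

end

end ReedyDiagonal

theorem mainTheorem1 {M : Type u} [Category.{v} M] [ModelCategory M]
    [HasLimitsOfSize.{0, 0} M] [HasColimitsOfSize.{0, 0} M] (n : ℕ) (hn : 1 ≤ n) :
    ∃ (S : ModelCategory (ReedyDiagonal.MultiDelta n ⥤ M))
      (T : ModelCategory (SimplexCategory ⥤ M)),
      -- the Reedy model category structures
      ReedyDiagonal.IsReedyModelStructure (ReedyDiagonal.multiDeltaInverse n)
        (ReedyDiagonal.multiDeltaDirect n) S ∧
      ReedyDiagonal.IsReedyModelStructure ReedyDiagonal.deltaInverse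
        ReedyDiagonal.deltaDirect T ∧
      -- the diagonal is a right Quillen functor
      ReedyDiagonal.IsRightQuillen (ReedyDiagonal.diagonal n M) ∧
      -- its left adjoint is the left Kan extension along the diagonal embedding
      (∀ (F : (SimplexCategory ⥤ M) ⥤ (ReedyDiagonal.MultiDelta n ⥤ M))
        (adj : F ⊣ ReedyDiagonal.diagonal n M) (X : SimplexCategory ⥤ M),
        (F.obj X).IsLeftKanExtension (L := ReedyDiagonal.diagonalEmbedding n)
          (adj.unit.app X)) ∧
      -- it preserves fibrations and all weak equivalences
      (∀ {X Y : ReedyDiagonal.MultiDelta n ⥤ M} (f : X ⟶ Y),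
        fibrations _ f → fibrations _ ((ReedyDiagonal.diagonal n M).map f)) ∧
      (∀ {X Y : ReedyDiagonal.MultiDelta n ⥤ M} (f : X ⟶ Y),
        weakEquivalences _ f → weakEquivalences _ ((ReedyDiagonal.diagonal n M).map f)) := by
  let S := ReedyDiagonal.reedyModelCategory (M := M) (ReedyDiagonal.multiDeltaReedy n)
  let T := ReedyDiagonal.reedyModelCategory (M := M) ReedyDiagonal.deltaReedy
  have hfib {X Y : ReedyDiagonal.MultiDelta n ⥤ M} (f : X ⟶ Y) (hf : fibrations _ f) :
      fibrations _ ((ReedyDiagonal.diagonal n M).map f) :=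
    ReedyDiagonal.relativeMatching_diagonal (trivialCofibrations M) (fibrations M) f hf
  have hw {X Y : ReedyDiagonal.MultiDelta n ⥤ M} (f : X ⟶ Y) (hf : weakEquivalences _ f) :
      weakEquivalences _ ((ReedyDiagonal.diagonal n M).map f) :=
    -- The component of the diagonal of f at [k] is the component of f at D[k].
    fun k => hf ((ReedyDiagonal.diagonalEmbedding n).obj k)
  refine ⟨S, T, ReedyDiagonal.isReedyModelStructure_reedyModelCategory _,
    ReedyDiagonal.isReedyModelStructure_reedyModelCategory _,
    ⟨(ReedyDiagonal.diagonalEmbedding n).lan, (ReedyDiagonal.diagonalEmbedding n).lanAdjunction M,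
      .of_rightAdjoint _ hfib fun f hf => ⟨hfib f hf.1, hw f hf.2⟩⟩,
    -- The unit at X is initial among maps from X to a restriction along D, which is the universal
    -- property of the left Kan extension.
    fun F adj X => ⟨⟨mkInitialOfLeftAdjoint _ adj X⟩⟩, hfib, hw⟩
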